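/- For $d\ge 1$ let $\pi(\mathbf x)\propto\exp(-\tfrac12\mathbf x^T\mathbf x)$ be the isotropic Gaussian density on $\mathbb R^d$, and let $\mathbf x_i,\mathbf x_j,\mathbf x_k$ be independent draws from $\pi$. Throughout, a proposal $\tilde{\mathbf x}_i$ with acceptance ratio $q$ is accepted or rejected by means of a variable $r\sim\mathrm{Unif}[0,1]$, independent of everything else: the new position is $\mathbf x_i'=\tilde{\mathbf x}_i$ if $r\le q$, and $\mathbf x_i'=\mathbf x_i$ otherwise. All limits are along integers $d\to\infty$. (i) Side move. Let $\alpha\in\mathbb R$ and $\sigma=\alpha/\sqrt d$, let $\tilde{\mathbf x}_i=\mathbf x_i+\sigma(\mathbf x_j-\mathbf x_k)\xi$ with $\xi\sim\mathcal N(0,1)$ independent of $\mathbf x_i,\mathbf x_j,\mathbf x_k$, and let $q=\pi(\tilde{\mathbf x}_i)/\pi(\mathbf x_i)$. Then $\|\mathbf x_i'-\mathbf x_i\|_2^2$ is integrable for every $d\ge1$, and $$\lim_{d\to\infty}\mathbb E\Big[\min\Big\{1,\frac{\pi(\tilde{\mathbf x}_i)}{\pi(\mathbf x_i)}\Big\}\Big]=\mathbb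 E\big[\min\{1,\exp(-\alpha^2\xi^2-\sqrt2\,\alpha\xi z)\}\big],$$ $$\lim_{d\to\infty}\mathbb E\big[\|\mathbf x_i'-\mathbf x_i\|_2^2\big]=2\alpha^2\,\mathbb E\big[\xi^2\min\{1,\exp(-\alpha^2\xi^2-\sqrt2\,\alpha\xi z)\}\big],$$ where on the right-hand sides $\xi,z\sim\mathcal N(0,1)$ are independent. (ii) Stretch move. Let $\beta>0$ and $a=1+\beta/\sqrt d$, let $\tilde{\mathbf x}_i=\mathbf x_j+Z(\mathbf x_i-\mathbf x_j)$, where $Z$ is independent of $\mathbf x_i,\mathbf x_j$ and has density $g(z)\propto z^{-1/2}$ on $[1/a,a]$ and $0$ elsewhere, and let $q=Z^{d-1}\pi(\tilde{\mathbf x}_i)/\pi(\mathbf x_i)$. Then $\|\mathbf x_i'-\mathbf x_i\|_2^2$ is integrable for every $d\ge1$, and $$\lim_{d\to\infty}\mathbb E\Big[\min\Big\{1,Z^{d-1}\frac{\pi(\tilde{\mathbf x}_i)}{\pi(\mathbf x_i)}\Big\}\Big]=\mathbb E\big[\min\{1,\exp(-\tfrac32\beta^2U^2-\sqrt3\,\beta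 Uz)\}\big],$$ $$\lim_{d\to\infty}\mathbb E\big[\|\mathbf x_i'-\mathbf x_i\|_2^2\big]=2\beta^2\,\mathbb E\big[U^2\min\{1,\exp(-\tfrac32\beta^2U^2-\sqrt3\,\beta Uz)\}\big],$$ where $U\sim\mathrm{Unif}[-1,1]$ is independent of $z\sim\mathcal N(0,1)$. -/

import Mathlib

open MeasureTheory ProbabilityTheory Filter Topology

noncomputable section

/-- The probability law on `E` whose density (with respect to the volume) is proportional to the
nonnegative function `f`, i.e. `f / ∫ f`. -/
def lawOfDensity {E : Type*} [MeasureSpace E] (f : E → ℝ) : Measure E :=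
  (∫⁻ x, ENNReal.ofReal (f x))⁻¹ • (volume : Measure E).withDensity (fun x => ENNReal.ofReal (f x))

/-- The unnormalised isotropic Gaussian density `π(x) ∝ exp (-xᵀx / 2)` on `ℝᵈ`. -/
def gaussDensity {d : ℕ} (x : EuclideanSpace ℝ (Fin d)) : ℝ :=
  Real.exp (-(1 / 2) * ‖x‖ ^ 2)

/-- The isotropic Gaussian target distribution on `ℝᵈ`. -/
def gaussTarget (d : ℕ) : Measure (EuclideanSpace ℝ (Fin d)) :=
  lawOfDensity gaussDensity

/-- The unnormalised density of the stretch variable: `1 / √z` on `[1/a, a]`, zero elsewhere. -/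
def stretchDensity (a : ℝ) : ℝ → ℝ :=
  Set.indicator (Set.Icc (1 / a) a) (fun z => 1 / √z)

/-- The law of the stretch variable `Z` with parameter `a`. -/
def stretchLaw (a : ℝ) : Measure ℝ :=
  lawOfDensity (stretchDensity a)

/-- The uniform distribution on the real interval `[a, b]`. -/
def unifLaw (a b : ℝ) : Measure ℝ :=
  ProbabilityTheory.cond volume (Set.Icc a b)

/-- The accept-reject step: from `x`, with proposal `y`, acceptance ratio `q` and the uniform draw
`r`, move to `y` if `r ≤ q` and stay at `x` otherwise. -/
def acceptReject {E : Type*} (x y : E) (q r : ℝ) : E :=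
  if r ≤ q then y else x

/-- Side move proposal `xᵢ + σ (xⱼ - xₖ) ξ`. -/
def sideProposal {d : ℕ} (σ : ℝ) (xi xj xk : EuclideanSpace ℝ (Fin d)) (ξ : ℝ) :
    EuclideanSpace ℝ (Fin d) :=
  xi + (σ * ξ) • (xj - xk)

/-- Acceptance ratio `π(x̃ᵢ) / π(xᵢ)` of the side move. -/
def sideRatio {d : ℕ} (σ : ℝ) (xi xj xk : EuclideanSpace ℝ (Fin d)) (ξ : ℝ) : ℝ :=
  gaussDensity (sideProposal σ xi xj xk ξ) / gaussDensity xi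

/-- New position of the `i`-th walker after one side move. -/
def sideNext {d : ℕ} (σ : ℝ) (xi xj xk : EuclideanSpace ℝ (Fin d)) (ξ r : ℝ) :
    EuclideanSpace ℝ (Fin d) :=
  acceptReject xi (sideProposal σ xi xj xk ξ) (sideRatio σ xi xj xk ξ) r

/-- Stretch move proposal `xⱼ + Z (xᵢ - xⱼ)`. -/
def stretchProposal {d : ℕ} (xi xj : EuclideanSpace ℝ (Fin d)) (Z : ℝ) :
    EuclideanSpace ℝ (Fin d) :=
  xj + Z • (xi - xj)

/-- Acceptance ratio `Z ^ (d - 1) π(x̃ᵢ) / π(xᵢ)` of the stretch move (used for `d ≥ 1`). -/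
def stretchRatio {d : ℕ} (xi xj : EuclideanSpace ℝ (Fin d)) (Z : ℝ) : ℝ :=
  Z ^ (d - 1) * (gaussDensity (stretchProposal xi xj Z) / gaussDensity xi)

/-- New position of the `i`-th walker after one stretch move. -/
def stretchNext {d : ℕ} (xi xj : EuclideanSpace ℝ (Fin d)) (Z r : ℝ) :
    EuclideanSpace ℝ (Fin d) :=
  acceptReject xi (stretchProposal xi xj Z) (stretchRatio xi xj Z) r

/-- The random inputs of one side move at stationarity: `xᵢ, xⱼ, xₖ` are drawn from the Gaussian
target, `ξ` is standard normal, `r` is uniform on `[0, 1]`, and all five are independent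
(their joint law is the product law). -/
def IsSideInput {Ω : Type*} [MeasurableSpace Ω] (P : Measure Ω) {d : ℕ}
    (xi xj xk : Ω → EuclideanSpace ℝ (Fin d)) (ξ r : Ω → ℝ) : Prop :=
  HasLaw (fun ω => (xi ω, xj ω, xk ω, ξ ω, r ω))
    ((gaussTarget d).prod ((gaussTarget d).prod ((gaussTarget d).prod
      ((gaussianReal 0 1).prod (unifLaw 0 1))))) P

/-- The random inputs of one stretch move with parameter `a` at stationarity: `xᵢ, xⱼ` are drawn
from the Gaussian target, `Z` has density proportional to `1 / √z` on `[1/a, a]`, `r` is uniform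
on `[0, 1]`, and all four are independent (their joint law is the product law). -/
def IsStretchInput {Ω : Type*} [MeasurableSpace Ω] (P : Measure Ω) {d : ℕ} (a : ℝ)
    (xi xj : Ω → EuclideanSpace ℝ (Fin d)) (Z r : Ω → ℝ) : Prop :=
  HasLaw (fun ω => (xi ω, xj ω, Z ω, r ω))
    ((gaussTarget d).prod ((gaussTarget d).prod ((stretchLaw a).prod (unifLaw 0 1)))) P

end

/-! Both log acceptance ratios are affine in two empirical averages, one governed by the central
limit theorem and one by the law of large numbers. For the side move, with ξ fixed, log q = -αξ S -
(α²ξ²/2) M, where S = d^(-1/2) ⟨xᵢ, xⱼ - xₖ⟩ and M = d⁻¹ ‖xⱼ - xₖ‖². The summands of S are centred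
with variance 2, so S tends to √2 z in law, while M tends to 2 in L¹. As s ↦ min(1, e^s) is bounded
and 1-Lipschitz, M can be replaced by its limit at an L¹ cost, and weak convergence handles S: this
is `tendsto_integral_min_one_exp`. Integrating out r turns the acceptance indicator into min(1, q)
(`integral_accept`), so the expected squared jump only adds a factor M, treated in
`tendsto_integral_mul_min_one_exp`. Dominated convergence in ξ then removes the conditioning.

For the stretch move put Z = 1 + βu/√d and b = βu. Now ⟨xᵢ, xᵢ - xⱼ⟩ has mean d, and its
contribution -b√d is cancelled by (d - 1) log Z up to a remainder tending to -b²/2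
(`tendsto_stretch_drift`). The centred summands 1 - x(x - y) have variance 3, and the quadratic term
contributes -b², so the limit exponent is -(3/2)b² - √3 b z. The law of u depends on d, but its
rescaled density converges to the uniform one on [-1, 1] (`tendsto_integral_stretchLaw`).

The statements involve only the joint law of the inputs for each d, so all dimensions are realised
on one space carrying an i.i.d. sequence of Gaussian triples; both limit theorems are applied there.
-/

section LawOfDensity

variable {E F : Type*} [MeasureSpace E] [NormedAddCommGroup F] [NormedSpace ℝ F]

lemma integral_lawOfDensity {g : E → ℝ} (hg : ∀ x, 0 ≤ g x) (hm : Measurable g)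
    (hi : Integrable g) (f : E → F) :
    ∫ x, f x ∂(lawOfDensity g) = (∫ x, g x)⁻¹ • ∫ x, g x • f x := by
  rw [lawOfDensity, integral_smul_measure,
    integral_withDensity_eq_integral_toReal_smul (by fun_prop) (by simp),
    ← ofReal_integral_eq_lintegral_ofReal hi (ae_of_all _ hg), ENNReal.toReal_inv,
    ENNReal.toReal_ofReal (integral_nonneg hg)]
  simp [ENNReal.toReal_ofReal (hg _)]

lemma isProbabilityMeasure_lawOfDensity {g : E → ℝ} (hg : ∀ x, 0 ≤ g x)
    (hi : Integrable g) (hpos : 0 < ∫ x, g x) :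
    IsProbabilityMeasure (lawOfDensity g) := by
  constructor
  rw [lawOfDensity, Measure.smul_apply, withDensity_apply _ MeasurableSet.univ,
    Measure.restrict_univ, smul_eq_mul,
    ← ofReal_integral_eq_lintegral_ofReal hi (ae_of_all _ hg)]
  exact ENNReal.inv_mul_cancel (by simpa using hpos) (by simp)

end LawOfDensity

/-! ### The Gaussian target as a product measure -/

lemma continuous_gaussDensity {d : ℕ} : Continuous (gaussDensity (d := d)) := by
  unfold gaussDensity; fun_prop

lemma gaussDensity_nonneg {d : ℕ} (x : EuclideanSpace ℝ (Fin d)) : 0 ≤ gaussDensity x :=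
  (Real.exp_pos _).le

lemma integrable_gaussDensity {d : ℕ} : Integrable (gaussDensity (d := d)) := by
  have h := (GaussianFourier.integrable_cexp_neg_mul_sq_norm_add (b := 1 / 2) (by norm_num) 0
    (0 : EuclideanSpace ℝ (Fin d))).re
  refine h.congr (ae_of_all _ fun x => ?_)
  simp only [gaussDensity, zero_mul, add_zero]
  rw [RCLike.re_eq_complex_re, ← Complex.exp_ofReal_re]
  push_cast
  rfl

lemma integral_gaussDensity_pos {d : ℕ} :
    0 < ∫ x : EuclideanSpace ℝ (Fin d), gaussDensity x := by
  simp only [gaussDensity]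
  rw [GaussianFourier.integral_rexp_neg_mul_sq_norm (by norm_num)]
  positivity

instance isProbabilityMeasure_gaussTarget (d : ℕ) : IsProbabilityMeasure (gaussTarget d) :=
  isProbabilityMeasure_lawOfDensity gaussDensity_nonneg integrable_gaussDensity
    integral_gaussDensity_pos

/-- Compare characteristic functions: the Gaussian Fourier integral at `t`, divided by its value at
0, is exp(-‖t‖²/2). The identification makes the coordinates i.i.d. standard normal. -/
lemma gaussTarget_eq_stdGaussian (d : ℕ) :
    gaussTarget d = stdGaussian (EuclideanSpace ℝ (Fin d)) := by
  apply Measure.ext_of_charFun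
  ext t
  rw [charFun_stdGaussian, charFun_apply, gaussTarget,
    integral_lawOfDensity gaussDensity_nonneg continuous_gaussDensity.measurable
      integrable_gaussDensity]
  have h1 := GaussianFourier.integral_cexp_neg_mul_sq_norm_add (b := 1 / 2) (by norm_num)
    Complex.I t
  have h0 := GaussianFourier.integral_cexp_neg_mul_sq_norm_add (b := 1 / 2) (by norm_num)
    (0 : ℂ) (0 : EuclideanSpace ℝ (Fin d))
  have e0 : ((∫ x : EuclideanSpace ℝ (Fin d), gaussDensity x : ℝ) : ℂ)
      = (Real.pi / (1 / 2 : ℂ)) ^ (Module.finrank ℝ (EuclideanSpace ℝ (Fin d)) / 2 : ℂ) := by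
    rw [← integral_complex_ofReal]
    simpa [gaussDensity] using h0
  have e1 : ∫ x : EuclideanSpace ℝ (Fin d), gaussDensity x • Complex.exp (inner ℝ x t * Complex.I)
      = ∫ v, Complex.exp (-(1 / 2) * ‖v‖ ^ 2 + Complex.I * inner ℝ t v) := by
    refine integral_congr_ae (ae_of_all _ fun x => ?_)
    simp only [gaussDensity, Complex.real_smul, Complex.ofReal_exp]
    rw [← Complex.exp_add, real_inner_comm]
    push_cast
    ring_nf
  have hne : ((∫ x : EuclideanSpace ℝ (Fin d), gaussDensity x : ℝ) : ℂ) ≠ 0 := by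
    exact_mod_cast integral_gaussDensity_pos.ne'
  rw [e1, h1, ← e0, Complex.real_smul, Complex.ofReal_inv, ← mul_assoc, inv_mul_cancel₀ hne,
    one_mul, Complex.I_sq]
  ring_nf

lemma gaussTarget_eq_map_pi (d : ℕ) :
    gaussTarget d = (Measure.pi fun _ : Fin d => gaussianReal 0 1).map (WithLp.toLp 2) := by
  rw [gaussTarget_eq_stdGaussian, map_pi_eq_stdGaussian]

/-! ### Moments of the standard normal law -/

section Moments

lemma integrable_pow_gaussianReal (n : ℕ) : Integrable (fun x => x ^ n) (gaussianReal 0 1) := by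
  have := (memLp_id_gaussianReal (μ := 0) (v := 1) n)
  rcases Nat.eq_zero_or_pos n with rfl | hn
  · simp
  · exact (this.integrable_norm_pow' (p := n)).mono' (by fun_prop) (ae_of_all _ fun x => by simp)

lemma integral_sq_gaussianReal : ∫ x, x ^ 2 ∂(gaussianReal 0 1) = 1 := by
  have h := variance_fun_id_gaussianReal (μ := 0) (v := 1)
  rw [variance_eq_integral (by fun_prop)] at h
  simpa using h

lemma integral_pow_four_gaussianReal : ∫ x, x ^ 4 ∂(gaussianReal 0 1) = 3 := by
  -- The fourth moment is the fourth derivative at 0 of the moment generating function exp(t²/2).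
  have h := iteratedDeriv_mgf_zero (X := id) (μ := gaussianReal 0 1)
    (by simp [integrableExpSet_id_gaussianReal]) 4
  simp only [Pi.pow_apply, id] at h
  rw [← h, mgf_id_gaussianReal]
  have e : ∀ t : ℝ, HasDerivAt (fun t : ℝ => Real.exp (t ^ 2 / 2)) (Real.exp (t ^ 2 / 2) * t) t := by
    intro t
    convert ((hasDerivAt_pow 2 t).div_const 2).exp using 1
    simp
  have d1 : deriv (fun t : ℝ => Real.exp (t ^ 2 / 2)) = fun t => Real.exp (t ^ 2 / 2) * t :=
    funext fun t => (e t).deriv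
  have d2 : deriv (fun t : ℝ => Real.exp (t ^ 2 / 2) * t)
      = fun t => Real.exp (t ^ 2 / 2) * (t ^ 2 + 1) := by
    funext t
    exact ((e t).mul (hasDerivAt_id' t)).congr_deriv (by ring) |>.deriv
  have d3 : deriv (fun t : ℝ => Real.exp (t ^ 2 / 2) * (t ^ 2 + 1))
      = fun t => Real.exp (t ^ 2 / 2) * (t ^ 3 + 3 * t) := by
    funext t
    exact ((e t).mul ((hasDerivAt_pow 2 t).add_const 1)).congr_deriv (by push_cast; ring) |>.deriv
  have d4 : deriv (fun t : ℝ => Real.exp (t ^ 2 / 2) * (t ^ 3 + 3 * t))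
      = fun t => Real.exp (t ^ 2 / 2) * (t ^ 4 + 6 * t ^ 2 + 3) := by
    funext t
    exact ((e t).mul ((hasDerivAt_pow 3 t).add ((hasDerivAt_id' t).const_mul 3))).congr_deriv (by simp only [Pi.add_apply]; push_cast; ring) |>.deriv
  simp [iteratedDeriv_succ, d1, d2, d3, d4]

end Moments

/-! ### Limits of expectations of min(1, e^s) -/

section MinOneExp

lemma min_one_exp_eq (s : ℝ) : min 1 (Real.exp s) = Real.exp (min 0 s) := by
  rw [← Real.exp_zero]
  exact (Real.exp_monotone.map_min).symm

/-- Since min(1, e^s) = e^(min(0, s)), this combines the 1-Lipschitz bounds for truncation at 0 and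
for exp on the nonpositive half-line; the latter follows from 1 + x ≤ e^x. -/
lemma abs_min_one_exp_sub_le (s t : ℝ) :
    |min 1 (Real.exp s) - min 1 (Real.exp t)| ≤ |s - t| := by
  wlog h : s ≤ t generalizing s t
  · rw [abs_sub_comm, abs_sub_comm s]
    exact this t s (le_of_not_ge h)
  rw [abs_sub_comm, abs_sub_comm s, abs_of_nonneg (sub_nonneg.2 h), min_one_exp_eq, min_one_exp_eq,
    abs_of_nonneg (sub_nonneg.2 (Real.exp_monotone (min_le_min_left 0 h)))]
  have h1 : Real.exp (min 0 t) ≤ 1 := Real.exp_le_one_iff.2 (min_le_left _ _)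
  have h2 : min 0 s - min 0 t + 1 ≤ Real.exp (min 0 s - min 0 t) := Real.add_one_le_exp _
  have h3 : Real.exp (min 0 s) = Real.exp (min 0 t) * Real.exp (min 0 s - min 0 t) := by
    rw [← Real.exp_add]; ring_nf
  have h4 : min 0 t - min 0 s ≤ t - s := by
    rcases le_total 0 t with ht | ht <;> rcases le_total 0 s with hs | hs <;>
      simp only [min_eq_left, min_eq_right, ht, hs] <;> linarith
  have h5 : min 0 s ≤ min 0 t := min_le_min_left 0 h
  nlinarith [Real.exp_pos (min 0 t)]

lemma abs_min_one_exp_le (s : ℝ) : |min 1 (Real.exp s)| ≤ 1 := by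
  rw [abs_of_nonneg (le_min zero_le_one (Real.exp_pos _).le)]
  exact min_le_left _ _

variable {Ω Ω' : Type*} [MeasurableSpace Ω] [MeasurableSpace Ω'] {P : Measure Ω} {P' : Measure Ω'}
  [IsProbabilityMeasure P] [IsProbabilityMeasure P'] {Y : Ω' → ℝ} {S M : ℕ → Ω → ℝ}

lemma MeasureTheory.TendstoInDistribution.tendsto_integral
    (hS : TendstoInDistribution S atTop Y (fun _ => P) P') {φ : ℝ → ℝ} (hφ : Continuous φ) {C : ℝ}
    (hC : ∀ x, |φ x| ≤ C) :
    Tendsto (fun d => ∫ ω, φ (S d ω) ∂P) atTop (𝓝 (∫ ω, φ (Y ω) ∂P')) := by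
  have h := ProbabilityMeasure.tendsto_iff_forall_integral_tendsto.1 hS.tendsto
    (BoundedContinuousFunction.ofNormedAddCommGroup φ hφ C hC)
  simp only [ProbabilityMeasure.coe_mk, BoundedContinuousFunction.coe_ofNormedAddCommGroup] at h
  rw [integral_map hS.aemeasurable_limit hφ.aestronglyMeasurable] at h
  exact h.congr fun d => integral_map (hS.forall_aemeasurable d) hφ.aestronglyMeasurable

lemma integrable_min_one_exp {f : Ω → ℝ} (hf : AEMeasurable f P) :
    Integrable (fun ω => min 1 (Real.exp (f ω))) P :=
  Integrable.of_bound (by fun_prop : AEMeasurable _ P).aestronglyMeasurable 1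
    (ae_of_all _ fun _ => abs_min_one_exp_le _)

/-- A Slutsky argument: by the Lipschitz bound, replacing `c d` and `M d` by their limits costs at
most |c d - c₀| + |m| E|M d - b|. What remains is a bounded continuous function of `S d`. No joint
convergence of `S` and `M` is required. -/
lemma tendsto_integral_min_one_exp (hS : TendstoInDistribution S atTop Y (fun _ => P) P')
    {b : ℝ} (hM : ∀ d, Integrable (M d) P)
    (hMb : Tendsto (fun d => ∫ ω, |M d ω - b| ∂P) atTop (𝓝 0)) {c : ℕ → ℝ} {c₀ : ℝ}
    (hc : Tendsto c atTop (𝓝 c₀)) (t m : ℝ) :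
    Tendsto (fun d => ∫ ω, min 1 (Real.exp (c d + t * S d ω - m * M d ω)) ∂P) atTop
      (𝓝 (∫ ω, min 1 (Real.exp (c₀ - m * b + t * Y ω)) ∂P')) := by
  have hlim := hS.tendsto_integral (φ := fun y => min 1 (Real.exp (c₀ - m * b + t * y)))
    (by fun_prop) (fun _ => abs_min_one_exp_le _)
  have hmeas := hS.forall_aemeasurable
  have hMm := fun d => (hM d).aemeasurable
  have hzero : Tendsto (fun d => |c d - c₀| + |m| * ∫ ω, |M d ω - b| ∂P) atTop (𝓝 0) := by
    have := (hc.sub_const c₀).abs.add (hMb.const_mul |m|)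
    simpa using this
  have hdiff : Tendsto (fun d => (∫ ω, min 1 (Real.exp (c d + t * S d ω - m * M d ω)) ∂P)
      - ∫ ω, min 1 (Real.exp (c₀ - m * b + t * S d ω)) ∂P) atTop (𝓝 0) := by
    refine squeeze_zero_norm (fun d => ?_) hzero
    have hi : Integrable (fun ω => |M d ω - b|) P := ((hM d).sub (integrable_const b)).abs
    rw [← integral_sub (integrable_min_one_exp (by fun_prop)) (integrable_min_one_exp (by fun_prop))]
    refine (norm_integral_le_of_norm_le
      ((integrable_const |c d - c₀|).add (hi.const_mul |m|)) (ae_of_all _ fun ω => ?_)).trans_eq ?_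
    · refine (abs_min_one_exp_sub_le _ _).trans ?_
      have : c d + t * S d ω - m * M d ω - (c₀ - m * b + t * S d ω)
          = (c d - c₀) + -(m * (M d ω - b)) := by ring
      rw [this]
      refine (abs_add_le _ _).trans_eq ?_
      rw [abs_neg, abs_mul]
      rfl
    · simp only [Pi.add_apply]
      rw [integral_add (integrable_const _) (hi.const_mul _), integral_const_mul]
      simp
  simpa using hdiff.add hlim

/-- The other factor lies in [0, 1], so replacing the prefactor `M d` by `b` costs at most E|M d -
b|. -/
lemma tendsto_integral_mul_min_one_exp (hS : TendstoInDistribution S atTop Y (fun _ => P) P')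
    {b : ℝ} (hM : ∀ d, Integrable (M d) P)
    (hMb : Tendsto (fun d => ∫ ω, |M d ω - b| ∂P) atTop (𝓝 0)) {c : ℕ → ℝ} {c₀ : ℝ}
    (hc : Tendsto c atTop (𝓝 c₀)) (t m : ℝ) :
    Tendsto (fun d => ∫ ω, M d ω * min 1 (Real.exp (c d + t * S d ω - m * M d ω)) ∂P) atTop
      (𝓝 (b * ∫ ω, min 1 (Real.exp (c₀ - m * b + t * Y ω)) ∂P')) := by
  have hlim := (tendsto_integral_min_one_exp hS hM hMb hc t m).const_mul b
  have hmeas := hS.forall_aemeasurable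
  have hMm := fun d => (hM d).aemeasurable
  have hdiff : Tendsto (fun d =>
      (∫ ω, M d ω * min 1 (Real.exp (c d + t * S d ω - m * M d ω)) ∂P)
      - b * ∫ ω, min 1 (Real.exp (c d + t * S d ω - m * M d ω)) ∂P) atTop (𝓝 0) := by
    refine squeeze_zero_norm (fun d => ?_) hMb
    have hi : Integrable (fun ω => |M d ω - b|) P := ((hM d).sub (integrable_const b)).abs
    have hq : Integrable (fun ω => min 1 (Real.exp (c d + t * S d ω - m * M d ω))) P :=
      integrable_min_one_exp (by fun_prop)
    have hMq : Integrable (fun ω => M d ω * min 1 (Real.exp (c d + t * S d ω - m * M d ω))) P :=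
      (hM d).mul_bdd (c := 1) hq.aestronglyMeasurable (ae_of_all _ fun _ => abs_min_one_exp_le _)
    rw [← integral_const_mul, ← integral_sub hMq (hq.const_mul b)]
    refine norm_integral_le_of_norm_le hi (ae_of_all _ fun ω => ?_)
    rw [← sub_mul, norm_mul]
    exact mul_le_of_le_one_right (norm_nonneg _) (abs_min_one_exp_le _)
  simpa using hdiff.add hlim

end MinOneExp

/-! ### Integrating out the uniform acceptance variable -/

section AcceptReject

instance isProbabilityMeasure_unifLaw_zero_one : IsProbabilityMeasure (unifLaw 0 1) :=
  cond_isProbabilityMeasure_of_finite (by simp) (by simp)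

lemma unifLaw_zero_one : unifLaw 0 1 = volume.restrict (Set.Icc 0 1) := by
  simp [unifLaw, ProbabilityTheory.cond]

lemma integral_ite_le_unifLaw {q : ℝ} (hq : 0 ≤ q) (c : ℝ) :
    ∫ r, (if r ≤ q then c else 0) ∂(unifLaw 0 1) = c * min 1 q := by
  have h : (fun r : ℝ => if r ≤ q then c else 0) = (Set.Iic q).indicator fun _ => c := by
    ext r; simp [Set.indicator_apply]
  rw [h, integral_indicator measurableSet_Iic, unifLaw_zero_one,
    Measure.restrict_restrict measurableSet_Iic, integral_const]
  have : Set.Iic q ∩ Set.Icc 0 1 = Set.Icc 0 (min 1 q) := by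
    ext r; simp [Set.mem_Icc]; tauto
  rw [this, smul_eq_mul, mul_comm]
  rw [measureReal_def, Measure.restrict_apply_univ, Real.volume_Icc, sub_zero,
    ENNReal.toReal_ofReal (le_min zero_le_one hq)]

variable {Ω : Type*} [MeasurableSpace Ω] {Q : Measure Ω} [IsProbabilityMeasure Q]
  {ν : Measure ℝ} [IsProbabilityMeasure ν] {k : ℝ → ℝ} {N : Ω → ℝ} {q : Ω → ℝ → ℝ}

omit [IsProbabilityMeasure Q] [IsProbabilityMeasure ν] in
lemma integrable_accept (hk : Integrable k ν) (hN : Integrable N Q)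
    (hq : Measurable (Function.uncurry q)) :
    Integrable (fun p : Ω × ℝ × ℝ => if p.2.2 ≤ q p.1 p.2.1 then k p.2.1 * N p.1 else 0)
      (Q.prod (ν.prod (unifLaw 0 1))) := by
  have h1 : Integrable (fun p : Ω × ℝ × ℝ => N p.1 * (k p.2.1 * 1))
      (Q.prod (ν.prod (unifLaw 0 1))) :=
    hN.mul_prod (hk.mul_prod (integrable_const 1))
  have hs : MeasurableSet {p : Ω × ℝ × ℝ | p.2.2 ≤ q p.1 p.2.1} :=
    measurableSet_le (by fun_prop)
      (hq.comp (f := fun p : Ω × ℝ × ℝ => (p.1, p.2.1)) (by fun_prop))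
  refine (h1.indicator hs).congr (ae_of_all _ fun p => ?_)
  simp [Set.indicator_apply, mul_comm]

/-- Given the proposal, acceptance has probability min(1, q); Fubini then isolates the scalar
variable `z`, so that limits can be taken with `z` fixed. Nonnegativity of `q` is asked only almost
everywhere in `z` because the factor z^(d-1) of the stretch ratio can be negative off the support of
its law. -/
lemma integral_accept (hk : Integrable k ν) (hN : Integrable N Q)
    (hq : Measurable (Function.uncurry q)) (hq0 : ∀ᵐ z ∂ν, ∀ ω, 0 ≤ q ω z) :
    ∫ p : Ω × ℝ × ℝ, (if p.2.2 ≤ q p.1 p.2.1 then k p.2.1 * N p.1 else 0)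
        ∂(Q.prod (ν.prod (unifLaw 0 1)))
      = ∫ z, k z * ∫ ω, N ω * min 1 (q ω z) ∂Q ∂ν := by
  have hmp := measurePreserving_prodAssoc Q ν (unifLaw 0 1)
  have hI := (hmp.integrable_comp_emb MeasurableEquiv.prodAssoc.measurableEmbedding).2
    (integrable_accept hk hN hq)
  simp only [Function.comp_def] at hI
  have hq0' : ∀ᵐ p : Ω × ℝ ∂(Q.prod ν), 0 ≤ q p.1 p.2 := by
    filter_upwards [Measure.quasiMeasurePreserving_snd.ae hq0] with p hp using hp p.1
  rw [← hmp.integral_comp MeasurableEquiv.prodAssoc.measurableEmbedding, integral_prod _ hI]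
  simp only [MeasurableEquiv.prodAssoc, MeasurableEquiv.coe_mk, Equiv.prodAssoc_apply]
  rw [integral_congr_ae (hq0'.mono fun p hp => integral_ite_le_unifLaw hp (k p.2 * N p.1))]
  have hI2 : Integrable (fun p : Ω × ℝ => k p.2 * N p.1 * min 1 (q p.1 p.2)) (Q.prod ν) := by
    refine Integrable.mul_bdd (c := 1)
      ((hN.mul_prod hk).congr (ae_of_all _ fun p => mul_comm _ _)) ?_ (hq0'.mono fun p hp => ?_)
    · exact (measurable_const.min hq).aestronglyMeasurable
    · rw [Real.norm_of_nonneg (le_min zero_le_one hp)]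
      exact min_le_left _ _
  rw [integral_prod_symm _ hI2]
  simp_rw [mul_assoc, integral_const_mul]

lemma integral_min_one_prod (hq : Measurable (Function.uncurry q))
    (hq0 : ∀ᵐ z ∂ν, ∀ ω, 0 ≤ q ω z) :
    ∫ p : Ω × ℝ × ℝ, min 1 (q p.1 p.2.1) ∂(Q.prod (ν.prod (unifLaw 0 1)))
      = ∫ z, ∫ ω, min 1 (q ω z) ∂Q ∂ν := by
  have hmp := measurePreserving_prodAssoc Q ν (unifLaw 0 1)
  have hq0' : ∀ᵐ p : Ω × ℝ ∂(Q.prod ν), 0 ≤ q p.1 p.2 := by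
    filter_upwards [Measure.quasiMeasurePreserving_snd.ae hq0] with p hp using hp p.1
  rw [← hmp.integral_comp MeasurableEquiv.prodAssoc.measurableEmbedding]
  simp only [MeasurableEquiv.prodAssoc, MeasurableEquiv.coe_mk, Equiv.prodAssoc_apply]
  have hI2 : Integrable (fun p : Ω × ℝ => min 1 (q p.1 p.2)) (Q.prod ν) := by
    refine Integrable.of_bound (measurable_const.min hq).aestronglyMeasurable 1
      (hq0'.mono fun p hp => ?_)
    rw [Real.norm_of_nonneg (le_min zero_le_one hp)]
    exact min_le_left _ _
  rw [integral_fun_fst (fun p : Ω × ℝ => min 1 (q p.1 p.2)), integral_prod_symm _ hI2]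
  simp

end AcceptReject

/-! ### Limit theorems for i.i.d. coordinates, and the coupling of all dimensions -/

noncomputable section

section IIDSequence

variable {X : Type*} [MeasurableSpace X] {μ : Measure X} [IsProbabilityMeasure μ] {f : X → ℝ}

lemma iIndepFun_comp_eval_infinitePi (hf : Measurable f) :
    iIndepFun (fun (k : ℕ) (ω : ℕ → X) => f (ω k)) (Measure.infinitePi fun _ => μ) :=
  iIndepFun_infinitePi (X := fun _ => f) (fun _ => hf)

lemma measurable_comp_eval (hf : Measurable f) (k : ℕ) :
    Measurable fun ω : ℕ → X => f (ω k) :=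
  hf.comp (measurable_pi_apply k)

lemma hasLaw_comp_eval_infinitePi (hf : Measurable f) (k : ℕ) :
    HasLaw (fun ω : ℕ → X => f (ω k)) (μ.map f) (Measure.infinitePi fun _ => μ) :=
  ((⟨hf, rfl⟩ : MeasurePreserving f μ (μ.map f)).comp
    (measurePreserving_eval_infinitePi (fun _ : ℕ => μ) k)).hasLaw

lemma identDistrib_comp_eval_infinitePi (hf : Measurable f) (k : ℕ) :
    IdentDistrib (fun ω : ℕ → X => f (ω k)) (fun ω : ℕ → X => f (ω 0))
      (Measure.infinitePi fun _ => μ) (Measure.infinitePi fun _ => μ) :=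
  ⟨(measurable_comp_eval hf k).aemeasurable, (measurable_comp_eval hf 0).aemeasurable, by
    rw [(hasLaw_comp_eval_infinitePi hf k).map_eq, (hasLaw_comp_eval_infinitePi hf 0).map_eq]⟩

lemma integral_comp_eval_infinitePi (hf : Measurable f) (k : ℕ) :
    ∫ ω : ℕ → X, f (ω k) ∂(Measure.infinitePi fun _ => μ) = ∫ x, f x ∂μ :=
  ((measurePreserving_eval_infinitePi (fun _ : ℕ => μ) k).hasLaw).integral_comp
    hf.aestronglyMeasurable

lemma memLp_comp_eval_infinitePi {p : ENNReal} (hfp : MemLp f p μ) (k : ℕ) :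
    MemLp (fun ω : ℕ → X => f (ω k)) p (Measure.infinitePi fun _ => μ) :=
  hfp.comp_measurePreserving (measurePreserving_eval_infinitePi (fun _ : ℕ => μ) k)

/-- The central limit theorem for a centred function of i.i.d. coordinates. -/
lemma tendstoInDistribution_sum_infinitePi (hf : Measurable f) (hf2 : MemLp f 2 μ)
    (h0 : ∫ x, f x ∂μ = 0) {s : ℝ} (hs : ∫ x, f x ^ 2 ∂μ = s ^ 2) :
    TendstoInDistribution
      (fun (d : ℕ) (ω : ℕ → X) => (√(d : ℝ))⁻¹ * ∑ k ∈ Finset.range d, f (ω k)) atTop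
      (fun z => s * z) (fun _ => Measure.infinitePi fun _ => μ) (gaussianReal 0 1) := by
  have hmean : ∫ ω : ℕ → X, f (ω 0) ∂(Measure.infinitePi fun _ => μ) = 0 := by
    rw [integral_comp_eval_infinitePi hf, h0]
  have hvar : Var[fun ω : ℕ → X => f (ω 0); Measure.infinitePi fun _ => μ] = s ^ 2 := by
    rw [variance_eq_integral (measurable_comp_eval hf 0).aemeasurable, hmean]
    simp only [sub_zero]
    rw [integral_comp_eval_infinitePi (f := fun x => f x ^ 2) (by fun_prop), hs]
  -- Only s² enters the law of s z, so `s` may be negative; the stretch move uses this.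
  have hY : HasLaw (fun z : ℝ => s * z)
      (gaussianReal 0 Var[fun ω : ℕ → X => f (ω 0); Measure.infinitePi fun _ => μ].toNNReal)
      (gaussianReal 0 1) := by
    refine ⟨by fun_prop, ?_⟩
    rw [gaussianReal_map_const_mul, hvar]
    congr 1
    · simp
    · ext; simp [sq_nonneg]
  have h := tendstoInDistribution_inv_sqrt_mul_sum_sub
    (X := fun (k : ℕ) (ω : ℕ → X) => f (ω k)) hY (memLp_comp_eval_infinitePi hf2 0)
    (iIndepFun_comp_eval_infinitePi hf) (identDistrib_comp_eval_infinitePi hf)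
  simpa only [hmean, mul_zero, sub_zero] using h

/-- The `L¹` law of large numbers for a function of i.i.d. coordinates. -/
lemma tendsto_integral_abs_average_sub_infinitePi (hf : Measurable f) (hfi : Integrable f μ) :
    Tendsto (fun d : ℕ => ∫ ω : ℕ → X, |(d : ℝ)⁻¹ * ∑ k ∈ Finset.range d, f (ω k) - ∫ x, f x ∂μ|
      ∂(Measure.infinitePi fun _ => μ)) atTop (𝓝 0) := by
  have h := strong_law_Lp le_rfl ENNReal.one_ne_top
    (fun (k : ℕ) (ω : ℕ → X) => f (ω k))
    (memLp_comp_eval_infinitePi (memLp_one_iff_integrable.2 hfi) 0)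
    (fun i j hij => (iIndepFun_comp_eval_infinitePi hf).indepFun hij)
    (identDistrib_comp_eval_infinitePi hf)
  simp only [integral_comp_eval_infinitePi hf] at h
  have h' := (ENNReal.tendsto_toReal ENNReal.zero_ne_top).comp h
  refine h'.congr fun d => ?_
  simp only [Function.comp_apply, eLpNorm_one_eq_lintegral_enorm, smul_eq_mul]
  rw [← integral_norm_eq_lintegral_enorm]
  · rfl
  · exact (by fun_prop : Measurable _).aestronglyMeasurable

lemma integrable_average_infinitePi (hfi : Integrable f μ) (d : ℕ) :
    Integrable (fun ω : ℕ → X => (d : ℝ)⁻¹ * ∑ k ∈ Finset.range d, f (ω k))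
      (Measure.infinitePi fun _ => μ) :=
  (integrable_finsetSum _ fun k _ => memLp_one_iff_integrable.1
    (memLp_comp_eval_infinitePi (memLp_one_iff_integrable.2 hfi) k)).const_mul _

lemma integral_average_infinitePi (hf : Measurable f) (hfi : Integrable f μ) {d : ℕ} (hd : d ≠ 0) :
    ∫ ω : ℕ → X, (d : ℝ)⁻¹ * ∑ k ∈ Finset.range d, f (ω k) ∂(Measure.infinitePi fun _ => μ)
      = ∫ x, f x ∂μ := by
  rw [integral_const_mul, integral_finsetSum _ fun k _ => memLp_one_iff_integrable.1
    (memLp_comp_eval_infinitePi (memLp_one_iff_integrable.2 hfi) k)]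
  simp [integral_comp_eval_infinitePi hf, hd]

end IIDSequence

/-- The law of three independent standard normal variables. -/
def gaussTriple : Measure (ℝ × ℝ × ℝ) :=
  (gaussianReal 0 1).prod ((gaussianReal 0 1).prod (gaussianReal 0 1))

instance isProbabilityMeasure_gaussTriple : IsProbabilityMeasure gaussTriple := by
  unfold gaussTriple; infer_instance

/-- The law of an i.i.d. sequence of triples of independent standard normal variables. -/
def gaussTripleSeq : Measure (ℕ → ℝ × ℝ × ℝ) :=
  Measure.infinitePi fun _ => gaussTriple

instance isProbabilityMeasure_gaussTripleSeq : IsProbabilityMeasure gaussTripleSeq := by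
  unfold gaussTripleSeq; infer_instance

/-- The vector of the first `d` values of `f` along the sequence `ω`. -/
def seqVec {X : Type*} (d : ℕ) (f : X → ℝ) (ω : ℕ → X) : EuclideanSpace ℝ (Fin d) :=
  WithLp.toLp 2 fun i => f (ω i)

@[fun_prop]
lemma measurable_seqVec {X : Type*} [MeasurableSpace X] {d : ℕ} {f : X → ℝ} (hf : Measurable f) :
    Measurable (seqVec d f) := by
  unfold seqVec; fun_prop

/-- The first `d` triples have a product law; exchanging a vector of triples for a triple of vectors
preserves it, and each component is then a vector of i.i.d. normals, that is, a draw from the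
target. -/
lemma hasLaw_seqVec_triple (d : ℕ) :
    HasLaw (fun ω => (seqVec d (fun p : ℝ × ℝ × ℝ => p.1) ω, seqVec d (fun p => p.2.1) ω,
        seqVec d (fun p => p.2.2) ω))
      ((gaussTarget d).prod ((gaussTarget d).prod (gaussTarget d))) gaussTripleSeq := by
  have h1 : MeasurePreserving (fun (ω : ℕ → ℝ × ℝ × ℝ) (i : Fin d) => ω i) gaussTripleSeq
      (Measure.pi fun _ => gaussTriple) := by
    refine ⟨by fun_prop, ?_⟩
    rw [gaussTripleSeq, Measure.map_infinitePi_infinitePi_of_inj (f := fun i : Fin d => (i : ℕ))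
      Fin.val_injective, Measure.infinitePi_eq_pi]
  have h2 := measurePreserving_arrowProdEquivProdArrow ℝ (ℝ × ℝ) (Fin d)
    (fun _ => gaussianReal 0 1) (fun _ => (gaussianReal 0 1).prod (gaussianReal 0 1))
  have h3 := measurePreserving_arrowProdEquivProdArrow ℝ ℝ (Fin d)
    (fun _ => gaussianReal 0 1) (fun _ => gaussianReal 0 1)
  have h4 : MeasurePreserving (WithLp.toLp 2)
      (Measure.pi fun _ : Fin d => gaussianReal 0 1) (gaussTarget d) :=
    ⟨by fun_prop, (gaussTarget_eq_map_pi d).symm⟩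
  exact ((h4.prod ((h4.prod h4).comp h3)).comp (h2.comp h1)).hasLaw

lemma hasLaw_seqVec_pair (d : ℕ) :
    HasLaw (fun ω => (seqVec d (fun p : ℝ × ℝ × ℝ => p.1) ω, seqVec d (fun p => p.2.1) ω))
      ((gaussTarget d).prod (gaussTarget d)) gaussTripleSeq :=
  ((MeasurePreserving.id (gaussTarget d)).prod
    (measurePreserving_fst (μ := gaussTarget d) (ν := gaussTarget d))).hasLaw.comp
    (hasLaw_seqVec_triple d)

/-- Independent inputs of the side move, built from an i.i.d. sequence of triples. -/
lemma hasLaw_side_coupling (d : ℕ) (ν : Measure (ℝ × ℝ)) [IsProbabilityMeasure ν] :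
    HasLaw (fun p : (ℕ → ℝ × ℝ × ℝ) × ℝ × ℝ => (seqVec d (fun p => p.1) p.1,
        seqVec d (fun p => p.2.1) p.1, seqVec d (fun p => p.2.2) p.1, p.2))
      ((gaussTarget d).prod ((gaussTarget d).prod ((gaussTarget d).prod ν)))
      (gaussTripleSeq.prod ν) := by
  have h := ((hasLaw_seqVec_triple d).measurePreserving (by fun_prop)).prod
    (MeasurePreserving.id ν)
  have h1 := measurePreserving_prodAssoc (gaussTarget d)
    ((gaussTarget d).prod (gaussTarget d)) ν
  have h2 := (MeasurePreserving.id (gaussTarget d)).prod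
    (measurePreserving_prodAssoc (gaussTarget d) (gaussTarget d) ν)
  exact (h2.comp (h1.comp h)).hasLaw

/-- Independent inputs of the stretch move, built from an i.i.d. sequence of triples. -/
lemma hasLaw_stretch_coupling (d : ℕ) (ν : Measure (ℝ × ℝ)) [IsProbabilityMeasure ν] :
    HasLaw (fun p : (ℕ → ℝ × ℝ × ℝ) × ℝ × ℝ => (seqVec d (fun p => p.1) p.1,
        seqVec d (fun p => p.2.1) p.1, p.2))
      ((gaussTarget d).prod ((gaussTarget d).prod ν)) (gaussTripleSeq.prod ν) := by
  have h := ((hasLaw_seqVec_pair d).measurePreserving (by fun_prop)).prod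
    (MeasurePreserving.id ν)
  exact ((measurePreserving_prodAssoc (gaussTarget d) (gaussTarget d) ν).comp h).hasLaw

section SeqVec

variable {X : Type*} {d : ℕ} {f g : X → ℝ}

lemma seqVec_sub (ω : ℕ → X) :
    seqVec d f ω - seqVec d g ω = seqVec d (fun x => f x - g x) ω := by
  ext i; simp [seqVec]

lemma inner_seqVec (ω : ℕ → X) :
    inner ℝ (seqVec d f ω) (seqVec d g ω) = ∑ k ∈ Finset.range d, f (ω k) * g (ω k) := by
  rw [Finset.sum_range]
  simp [seqVec, PiLp.inner_apply, mul_comm]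

lemma norm_sq_seqVec (ω : ℕ → X) :
    ‖seqVec d f ω‖ ^ 2 = ∑ k ∈ Finset.range d, f (ω k) ^ 2 := by
  rw [← real_inner_self_eq_norm_sq, inner_seqVec]
  simp_rw [pow_two]

end SeqVec

/-! ### Means and variances of the summands -/

section Moments

lemma integrable_monomial_gaussTriple (a b c : ℕ) :
    Integrable (fun p : ℝ × ℝ × ℝ => p.1 ^ a * (p.2.1 ^ b * p.2.2 ^ c)) gaussTriple :=
  (integrable_pow_gaussianReal a).mul_prod
    ((integrable_pow_gaussianReal b).mul_prod (integrable_pow_gaussianReal c))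

lemma integral_monomial_gaussTriple (a b c : ℕ) :
    ∫ p : ℝ × ℝ × ℝ, p.1 ^ a * (p.2.1 ^ b * p.2.2 ^ c) ∂gaussTriple
      = (∫ x, x ^ a ∂(gaussianReal 0 1)) * ((∫ x, x ^ b ∂(gaussianReal 0 1))
        * ∫ x, x ^ c ∂(gaussianReal 0 1)) := by
  rw [gaussTriple, integral_prod_mul (fun x : ℝ => x ^ a) (fun p : ℝ × ℝ => p.1 ^ b * p.2 ^ c),
    integral_prod_mul (fun x : ℝ => x ^ b) (fun x : ℝ => x ^ c)]

/-- A polynomial in three variables given by a list of coefficients and exponents. -/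
def polyTriple (l : List (ℝ × ℕ × ℕ × ℕ)) (p : ℝ × ℝ × ℝ) : ℝ :=
  (l.map fun m => m.1 * (p.1 ^ m.2.1 * (p.2.1 ^ m.2.2.1 * p.2.2 ^ m.2.2.2))).sum

lemma integrable_polyTriple (l : List (ℝ × ℕ × ℕ × ℕ)) :
    Integrable (polyTriple l) gaussTriple := by
  induction l with
  | nil => exact integrable_zero _ _ _
  | cons m l ih =>
    exact (((integrable_monomial_gaussTriple m.2.1 m.2.2.1 m.2.2.2).const_mul m.1).add ih).congr
      (ae_of_all _ fun p => by simp [polyTriple])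

/-- Reduces each expectation below to one-dimensional moments. Every monomial with an odd exponent
that occurs there has a factor of exponent 1, hence mean zero, so only the second and fourth moments
are needed besides. -/
lemma integral_polyTriple (l : List (ℝ × ℕ × ℕ × ℕ)) :
    ∫ p, polyTriple l p ∂gaussTriple = (l.map fun m => m.1 * ((∫ x, x ^ m.2.1 ∂(gaussianReal 0 1))
      * ((∫ x, x ^ m.2.2.1 ∂(gaussianReal 0 1)) * ∫ x, x ^ m.2.2.2 ∂(gaussianReal 0 1)))).sum := by
  induction l with
  | nil => simp [polyTriple]
  | cons m l ih =>
    have h : polyTriple (m :: l)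
        = fun p => m.1 * (p.1 ^ m.2.1 * (p.2.1 ^ m.2.2.1 * p.2.2 ^ m.2.2.2)) + polyTriple l p := by
      ext p; simp [polyTriple]
    rw [h, integral_add ((integrable_monomial_gaussTriple _ _ _).const_mul _)
      (integrable_polyTriple l), integral_const_mul, integral_monomial_gaussTriple, ih]
    simp

lemma sideField_sq (p : ℝ × ℝ × ℝ) : (p.1 * (p.2.1 - p.2.2)) ^ 2
    = polyTriple [(1, 2, 2, 0), (-2, 2, 1, 1), (1, 2, 0, 2)] p := by
  simp [polyTriple]; ring

lemma memLp_sideField : MemLp (fun p : ℝ × ℝ × ℝ => p.1 * (p.2.1 - p.2.2)) 2 gaussTriple := by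
  rw [memLp_two_iff_integrable_sq (by fun_prop : Measurable _).aestronglyMeasurable]
  simp_rw [sideField_sq]
  exact integrable_polyTriple _

lemma integral_sideField : ∫ p : ℝ × ℝ × ℝ, p.1 * (p.2.1 - p.2.2) ∂gaussTriple = 0 := by
  have h (p : ℝ × ℝ × ℝ) : p.1 * (p.2.1 - p.2.2)
      = polyTriple [(1, 1, 1, 0), (-1, 1, 0, 1)] p := by
    simp [polyTriple]; ring
  simp_rw [h, integral_polyTriple]
  simp

lemma integral_sideField_sq :
    ∫ p : ℝ × ℝ × ℝ, (p.1 * (p.2.1 - p.2.2)) ^ 2 ∂gaussTriple = √2 ^ 2 := by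
  simp_rw [sideField_sq, integral_polyTriple]
  simp [integral_sq_gaussianReal]
  norm_num

lemma stretchField_sq (p : ℝ × ℝ × ℝ) : (1 - p.1 * (p.1 - p.2.1)) ^ 2
    = polyTriple [(1, 0, 0, 0), (1, 4, 0, 0), (1, 2, 2, 0), (-2, 2, 0, 0), (2, 1, 1, 0),
        (-2, 3, 1, 0)] p := by
  simp [polyTriple]; ring

lemma memLp_stretchField :
    MemLp (fun p : ℝ × ℝ × ℝ => 1 - p.1 * (p.1 - p.2.1)) 2 gaussTriple := by
  rw [memLp_two_iff_integrable_sq (by fun_prop : Measurable _).aestronglyMeasurable]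
  simp_rw [stretchField_sq]
  exact integrable_polyTriple _

lemma integral_stretchField : ∫ p : ℝ × ℝ × ℝ, 1 - p.1 * (p.1 - p.2.1) ∂gaussTriple = 0 := by
  have h (p : ℝ × ℝ × ℝ) : 1 - p.1 * (p.1 - p.2.1)
      = polyTriple [(1, 0, 0, 0), (-1, 2, 0, 0), (1, 1, 1, 0)] p := by
    simp [polyTriple]; ring
  simp_rw [h, integral_polyTriple]
  simp [integral_sq_gaussianReal]

lemma integral_stretchField_sq :
    ∫ p : ℝ × ℝ × ℝ, (1 - p.1 * (p.1 - p.2.1)) ^ 2 ∂gaussTriple = √3 ^ 2 := by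
  simp_rw [stretchField_sq, integral_polyTriple]
  simp [integral_sq_gaussianReal, integral_pow_four_gaussianReal]
  norm_num

lemma sideDiff_sq (p : ℝ × ℝ × ℝ) : (p.2.1 - p.2.2) ^ 2
    = polyTriple [(1, 0, 2, 0), (-2, 0, 1, 1), (1, 0, 0, 2)] p := by
  simp [polyTriple]; ring

lemma stretchDiff_sq (p : ℝ × ℝ × ℝ) : (p.1 - p.2.1) ^ 2
    = polyTriple [(1, 2, 0, 0), (-2, 1, 1, 0), (1, 0, 2, 0)] p := by
  simp [polyTriple]; ring

lemma integrable_sideDiff_sq :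
    Integrable (fun p : ℝ × ℝ × ℝ => (p.2.1 - p.2.2) ^ 2) gaussTriple := by
  simp_rw [sideDiff_sq]
  exact integrable_polyTriple _

lemma integrable_stretchDiff_sq :
    Integrable (fun p : ℝ × ℝ × ℝ => (p.1 - p.2.1) ^ 2) gaussTriple := by
  simp_rw [stretchDiff_sq]
  exact integrable_polyTriple _

lemma integral_sideDiff_sq : ∫ p : ℝ × ℝ × ℝ, (p.2.1 - p.2.2) ^ 2 ∂gaussTriple = 2 := by
  simp_rw [sideDiff_sq, integral_polyTriple]
  simp [integral_sq_gaussianReal]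
  norm_num

lemma integral_stretchDiff_sq : ∫ p : ℝ × ℝ × ℝ, (p.1 - p.2.1) ^ 2 ∂gaussTriple = 2 := by
  simp_rw [stretchDiff_sq, integral_polyTriple]
  simp [integral_sq_gaussianReal]
  norm_num

end Moments

end

lemma gaussDensity_add_div {d : ℕ} (x v : EuclideanSpace ℝ (Fin d)) (s : ℝ) :
    gaussDensity (x + s • v) / gaussDensity x
      = Real.exp (-s * inner ℝ x v - s ^ 2 / 2 * ‖v‖ ^ 2) := by
  simp only [gaussDensity]
  rw [← Real.exp_sub, norm_add_sq_real, norm_smul, inner_smul_right, mul_pow, Real.norm_eq_abs,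
    sq_abs]
  ring_nf

lemma norm_acceptReject_sub_sq {E : Type*} [NormedAddCommGroup E] (x y : E) (q r : ℝ) :
    ‖acceptReject x y q r - x‖ ^ 2 = if r ≤ q then ‖y - x‖ ^ 2 else 0 := by
  unfold acceptReject
  split_ifs <;> simp

/-! ### Transfer between spaces carrying the same joint law -/

section Transfer

variable {Ω Ω' E : Type*} [MeasurableSpace Ω] [MeasurableSpace Ω'] [MeasurableSpace E]
  {P : Measure Ω} {P' : Measure Ω'} {μ : Measure E} {X : Ω → E} {T : Ω' → E} {f : E → ℝ}

/-- Allows the given inputs, defined on spaces that vary with the dimension, to be replaced by the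
coupled ones. -/
lemma integral_comp_eq_of_hasLaw (hX : HasLaw X μ P) (hT : HasLaw T μ P') (hf : Measurable f) :
    ∫ ω, f (X ω) ∂P = ∫ ω, f (T ω) ∂P' :=
  (hX.integral_comp hf.aestronglyMeasurable).trans (hT.integral_comp hf.aestronglyMeasurable).symm

lemma integrable_comp_iff_of_hasLaw (hX : HasLaw X μ P) (hT : HasLaw T μ P')
    (hf : Measurable f) :
    Integrable (fun ω => f (X ω)) P ↔ Integrable (fun ω => f (T ω)) P' := by
  have h1 := integrable_map_measure (μ := P) (f := X) (g := f) hf.aestronglyMeasurable hX.aemeasurable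
  have h2 := integrable_map_measure (μ := P') (f := T) (g := f) hf.aestronglyMeasurable hT.aemeasurable
  rw [hX.map_eq] at h1
  rw [hT.map_eq] at h2
  exact h1.symm.trans h2

end Transfer

/-! ### The side move -/

section Side

/-- The acceptance ratio of the side move along an i.i.d. sequence of triples. -/
noncomputable def sideSeqRatio (α : ℝ) (d : ℕ) (ω : ℕ → ℝ × ℝ × ℝ) (ξ : ℝ) : ℝ :=
  Real.exp (0 + (-α * ξ) * ((√(d : ℝ))⁻¹ * ∑ k ∈ Finset.range d, (ω k).1 * ((ω k).2.1 - (ω k).2.2))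
    - (α ^ 2 * ξ ^ 2 / 2) * ((d : ℝ)⁻¹ * ∑ k ∈ Finset.range d, ((ω k).2.1 - (ω k).2.2) ^ 2))

lemma sideRatio_seqVec (α : ℝ) (d : ℕ) (ω : ℕ → ℝ × ℝ × ℝ) (ξ : ℝ) :
    sideRatio (α / √(d : ℝ)) (seqVec d (fun p => p.1) ω) (seqVec d (fun p => p.2.1) ω)
      (seqVec d (fun p => p.2.2) ω) ξ = sideSeqRatio α d ω ξ := by
  rw [sideRatio, sideProposal, gaussDensity_add_div, seqVec_sub, inner_seqVec, norm_sq_seqVec,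
    sideSeqRatio, mul_pow, div_pow, Real.sq_sqrt (Nat.cast_nonneg d)]
  ring_nf

lemma norm_sideNext_sub_sq (α : ℝ) (d : ℕ) (ω : ℕ → ℝ × ℝ × ℝ) (ξ r : ℝ) :
    ‖sideNext (α / √(d : ℝ)) (seqVec d (fun p => p.1) ω) (seqVec d (fun p => p.2.1) ω)
        (seqVec d (fun p => p.2.2) ω) ξ r - seqVec d (fun p => p.1) ω‖ ^ 2
      = if r ≤ sideSeqRatio α d ω ξ then
          α ^ 2 * ξ ^ 2 * ((d : ℝ)⁻¹ * ∑ k ∈ Finset.range d, ((ω k).2.1 - (ω k).2.2) ^ 2)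
        else 0 := by
  rw [sideNext, norm_acceptReject_sub_sq, sideRatio_seqVec, sideProposal, add_sub_cancel_left,
    norm_smul, mul_pow, seqVec_sub, norm_sq_seqVec, Real.norm_eq_abs, sq_abs, mul_pow, div_pow,
    Real.sq_sqrt (Nat.cast_nonneg d)]
  ring_nf

lemma measurable_sideSeqRatio (α : ℝ) (d : ℕ) :
    Measurable (Function.uncurry (sideSeqRatio α d)) := by
  unfold sideSeqRatio Function.uncurry; fun_prop

lemma sideSeqRatio_nonneg (α : ℝ) (d : ℕ) (ω : ℕ → ℝ × ℝ × ℝ) (ξ : ℝ) :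
    0 ≤ sideSeqRatio α d ω ξ :=
  (Real.exp_pos _).le

lemma measurable_sideRatio {d : ℕ} (σ : ℝ) :
    Measurable fun p : EuclideanSpace ℝ (Fin d) × EuclideanSpace ℝ (Fin d) ×
      EuclideanSpace ℝ (Fin d) × ℝ × ℝ => sideRatio σ p.1 p.2.1 p.2.2.1 p.2.2.2.1 := by
  unfold sideRatio sideProposal gaussDensity; fun_prop

lemma measurable_sideNext {d : ℕ} (σ : ℝ) :
    Measurable fun p : EuclideanSpace ℝ (Fin d) × EuclideanSpace ℝ (Fin d) ×
      EuclideanSpace ℝ (Fin d) × ℝ × ℝ =>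
      sideNext σ p.1 p.2.1 p.2.2.1 p.2.2.2.1 p.2.2.2.2 := by
  unfold sideNext acceptReject
  refine Measurable.ite (measurableSet_le (by fun_prop) (measurable_sideRatio σ)) ?_ (by fun_prop)
  unfold sideProposal; fun_prop

lemma integrable_average_sideDiff_sq (d : ℕ) :
    Integrable (fun ω : ℕ → ℝ × ℝ × ℝ =>
      (d : ℝ)⁻¹ * ∑ k ∈ Finset.range d, ((ω k).2.1 - (ω k).2.2) ^ 2) gaussTripleSeq :=
  integrable_average_infinitePi integrable_sideDiff_sq d

section Laws

variable {Ω : Type*} [MeasurableSpace Ω] {P : Measure Ω} {d : ℕ} {α : ℝ}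
  {xi xj xk : Ω → EuclideanSpace ℝ (Fin d)} {ξ r : Ω → ℝ}

lemma IsSideInput.integral_min_one_ratio (h : IsSideInput P xi xj xk ξ r) :
    ∫ ω, min 1 (sideRatio (α / √(d : ℝ)) (xi ω) (xj ω) (xk ω) (ξ ω)) ∂P
      = ∫ t, ∫ ω, min 1 (sideSeqRatio α d ω t) ∂gaussTripleSeq ∂(gaussianReal 0 1) := by
  rw [← integral_min_one_prod (measurable_sideSeqRatio α d)
    (ae_of_all _ fun t ω => sideSeqRatio_nonneg α d ω t)]
  refine (integral_comp_eq_of_hasLaw h (hasLaw_side_coupling d _)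
    ((measurable_const (a := (1 : ℝ))).min (measurable_sideRatio (α / √(d : ℝ))))).trans ?_
  simp only [sideRatio_seqVec]

lemma IsSideInput.integrable_norm_sq (h : IsSideInput P xi xj xk ξ r) :
    Integrable (fun ω => ‖sideNext (α / √(d : ℝ)) (xi ω) (xj ω) (xk ω) (ξ ω) (r ω) - xi ω‖ ^ 2)
      P := by
  refine (integrable_comp_iff_of_hasLaw h (hasLaw_side_coupling d _)
    (((measurable_sideNext (α / √(d : ℝ))).sub measurable_fst).norm.pow_const 2)).2 ?_
  simp only [Pi.sub_apply, norm_sideNext_sub_sq]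
  exact integrable_accept ((integrable_pow_gaussianReal 2).const_mul _)
    (integrable_average_sideDiff_sq d) (measurable_sideSeqRatio α d)

lemma IsSideInput.integral_norm_sq (h : IsSideInput P xi xj xk ξ r) :
    ∫ ω, ‖sideNext (α / √(d : ℝ)) (xi ω) (xj ω) (xk ω) (ξ ω) (r ω) - xi ω‖ ^ 2 ∂P
      = ∫ t, α ^ 2 * t ^ 2 * ∫ ω, ((d : ℝ)⁻¹ * ∑ k ∈ Finset.range d, ((ω k).2.1 - (ω k).2.2) ^ 2)
          * min 1 (sideSeqRatio α d ω t) ∂gaussTripleSeq ∂(gaussianReal 0 1) := by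
  rw [← integral_accept ((integrable_pow_gaussianReal 2).const_mul _)
    (integrable_average_sideDiff_sq d) (measurable_sideSeqRatio α d)
    (ae_of_all _ fun t ω => sideSeqRatio_nonneg α d ω t)]
  refine (integral_comp_eq_of_hasLaw h (hasLaw_side_coupling d _)
    (((measurable_sideNext (α / √(d : ℝ))).sub measurable_fst).norm.pow_const 2)).trans ?_
  simp only [Pi.sub_apply, norm_sideNext_sub_sq]

end Laws

lemma tendstoInDistribution_sideField :
    TendstoInDistribution (fun (d : ℕ) (ω : ℕ → ℝ × ℝ × ℝ) =>
      (√(d : ℝ))⁻¹ * ∑ k ∈ Finset.range d, (ω k).1 * ((ω k).2.1 - (ω k).2.2)) atTop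
      (fun z => √2 * z) (fun _ => gaussTripleSeq) (gaussianReal 0 1) :=
  tendstoInDistribution_sum_infinitePi (f := fun p : ℝ × ℝ × ℝ => p.1 * (p.2.1 - p.2.2))
    (by fun_prop) memLp_sideField integral_sideField integral_sideField_sq

lemma tendsto_integral_abs_average_sideDiff_sq :
    Tendsto (fun d : ℕ => ∫ ω : ℕ → ℝ × ℝ × ℝ,
      |(d : ℝ)⁻¹ * ∑ k ∈ Finset.range d, ((ω k).2.1 - (ω k).2.2) ^ 2 - 2| ∂gaussTripleSeq)
      atTop (𝓝 0) := by
  have h := tendsto_integral_abs_average_sub_infinitePi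
    (f := fun p : ℝ × ℝ × ℝ => (p.2.1 - p.2.2) ^ 2) (by fun_prop) integrable_sideDiff_sq
  rwa [integral_sideDiff_sq] at h

lemma side_exponent_eq (α ξ z : ℝ) :
    0 - α ^ 2 * ξ ^ 2 / 2 * 2 + -α * ξ * (√2 * z) = -α ^ 2 * ξ ^ 2 - √2 * α * ξ * z := by
  ring

lemma tendsto_integral_min_one_sideSeqRatio (α ξ : ℝ) :
    Tendsto (fun d => ∫ ω, min 1 (sideSeqRatio α d ω ξ) ∂gaussTripleSeq) atTop
      (𝓝 (∫ z, min 1 (Real.exp (-α ^ 2 * ξ ^ 2 - √2 * α * ξ * z)) ∂(gaussianReal 0 1))) := by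
  have h := tendsto_integral_min_one_exp tendstoInDistribution_sideField
    integrable_average_sideDiff_sq tendsto_integral_abs_average_sideDiff_sq
    (tendsto_const_nhds (x := (0 : ℝ))) (-α * ξ) (α ^ 2 * ξ ^ 2 / 2)
  simp only [side_exponent_eq] at h
  exact h

lemma tendsto_integral_mul_min_one_sideSeqRatio (α ξ : ℝ) :
    Tendsto (fun d : ℕ => ∫ ω, ((d : ℝ)⁻¹ * ∑ k ∈ Finset.range d, ((ω k).2.1 - (ω k).2.2) ^ 2)
        * min 1 (sideSeqRatio α d ω ξ) ∂gaussTripleSeq) atTop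
      (𝓝 (2 * ∫ z, min 1 (Real.exp (-α ^ 2 * ξ ^ 2 - √2 * α * ξ * z)) ∂(gaussianReal 0 1))) := by
  have h := tendsto_integral_mul_min_one_exp tendstoInDistribution_sideField
    integrable_average_sideDiff_sq tendsto_integral_abs_average_sideDiff_sq
    (tendsto_const_nhds (x := (0 : ℝ))) (-α * ξ) (α ^ 2 * ξ ^ 2 / 2)
  simp only [side_exponent_eq] at h
  exact h

lemma integral_average_sideDiff_sq {d : ℕ} (hd : d ≠ 0) :
    ∫ ω : ℕ → ℝ × ℝ × ℝ, (d : ℝ)⁻¹ * ∑ k ∈ Finset.range d, ((ω k).2.1 - (ω k).2.2) ^ 2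
      ∂gaussTripleSeq = 2 :=
  (integral_average_infinitePi (by fun_prop) integrable_sideDiff_sq hd).trans integral_sideDiff_sq

lemma abs_integral_mul_min_one_le {Ω : Type*} [MeasurableSpace Ω] {Q : Measure Ω} {N q : Ω → ℝ}
    (hN : Integrable N Q) (hN0 : ∀ ω, 0 ≤ N ω) (hq0 : ∀ ω, 0 ≤ q ω) :
    |∫ ω, N ω * min 1 (q ω) ∂Q| ≤ ∫ ω, N ω ∂Q := by
  rw [← Real.norm_eq_abs]
  refine norm_integral_le_of_norm_le hN (ae_of_all _ fun ω => ?_)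
  rw [Real.norm_of_nonneg (mul_nonneg (hN0 ω) (le_min zero_le_one (hq0 ω)))]
  exact mul_le_of_le_one_right (hN0 ω) (min_le_left _ _)

lemma abs_integral_min_one_le {Ω : Type*} [MeasurableSpace Ω] {Q : Measure Ω}
    [IsProbabilityMeasure Q] {q : Ω → ℝ} (hq0 : ∀ ω, 0 ≤ q ω) : |∫ ω, min 1 (q ω) ∂Q| ≤ 1 := by
  simpa using abs_integral_mul_min_one_le (integrable_const (μ := Q) (1 : ℝ))
    (fun _ => zero_le_one) hq0

lemma measurable_integral_mul_min_one {Ω : Type*} [MeasurableSpace Ω] {Q : Measure Ω} [SFinite Q]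
    {N : Ω → ℝ} {q : Ω → ℝ → ℝ} (hN : Measurable N) (hq : Measurable (Function.uncurry q)) :
    Measurable fun z => ∫ ω, N ω * min 1 (q ω z) ∂Q := by
  have h : Measurable fun p : ℝ × Ω => N p.2 * min 1 (q p.2 p.1) :=
    (hN.comp measurable_snd).mul (measurable_const.min (hq.comp measurable_swap))
  exact h.stronglyMeasurable.integral_prod_right.measurable

theorem tendsto_side_acceptance (α : ℝ) :
    Tendsto (fun d => ∫ t, ∫ ω, min 1 (sideSeqRatio α d ω t) ∂gaussTripleSeq ∂(gaussianReal 0 1))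
      atTop (𝓝 (∫ p : ℝ × ℝ, min 1 (Real.exp (-α ^ 2 * p.1 ^ 2 - √2 * α * p.1 * p.2))
          ∂((gaussianReal 0 1).prod (gaussianReal 0 1)))) := by
  rw [integral_prod _ (integrable_min_one_exp (by fun_prop))]
  refine tendsto_integral_of_dominated_convergence (fun _ => 1) (fun d => ?_) (integrable_const _)
    (fun d => ae_of_all _ fun t => abs_integral_min_one_le fun ω => sideSeqRatio_nonneg α d ω t)
    (ae_of_all _ fun t => tendsto_integral_min_one_sideSeqRatio α t)
  simpa using (measurable_integral_mul_min_one (Q := gaussTripleSeq) measurable_const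
    (measurable_sideSeqRatio α d) (N := fun _ => (1 : ℝ))).aestronglyMeasurable

theorem tendsto_side_jump (α : ℝ) :
    Tendsto (fun d : ℕ => ∫ t, α ^ 2 * t ^ 2 * ∫ ω,
        ((d : ℝ)⁻¹ * ∑ k ∈ Finset.range d, ((ω k).2.1 - (ω k).2.2) ^ 2)
          * min 1 (sideSeqRatio α d ω t) ∂gaussTripleSeq ∂(gaussianReal 0 1))
      atTop (𝓝 (2 * α ^ 2 * ∫ p : ℝ × ℝ,
          p.1 ^ 2 * min 1 (Real.exp (-α ^ 2 * p.1 ^ 2 - √2 * α * p.1 * p.2))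
          ∂((gaussianReal 0 1).prod (gaussianReal 0 1)))) := by
  have hI : Integrable (fun p : ℝ × ℝ =>
      p.1 ^ 2 * min 1 (Real.exp (-α ^ 2 * p.1 ^ 2 - √2 * α * p.1 * p.2)))
      ((gaussianReal 0 1).prod (gaussianReal 0 1)) :=
    ((integrable_pow_gaussianReal 2).comp_fst _).mul_bdd (c := 1)
      (by fun_prop : Measurable _).aestronglyMeasurable
      (ae_of_all _ fun _ => abs_min_one_exp_le _)
  rw [integral_prod _ hI, ← integral_const_mul]
  -- The factor 2 is the exact mean of the average for every d ≠ 0, so the dominating function does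
  -- not depend on `d`.
  refine tendsto_integral_filter_of_dominated_convergence (fun t => α ^ 2 * t ^ 2 * 2)
    (Eventually.of_forall fun d => ?_) ?_
    (((integrable_pow_gaussianReal 2).const_mul _).mul_const _)
    (ae_of_all _ fun t => ?_)
  · exact (Measurable.mul (by fun_prop) (measurable_integral_mul_min_one (by fun_prop)
      (measurable_sideSeqRatio α d))).aestronglyMeasurable
  · filter_upwards [eventually_ne_atTop 0] with d hd
    refine ae_of_all _ fun t => ?_
    rw [norm_mul, Real.norm_of_nonneg (by positivity)]
    refine mul_le_mul_of_nonneg_left ?_ (by positivity)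
    rw [← integral_average_sideDiff_sq hd]
    exact abs_integral_mul_min_one_le (integrable_average_sideDiff_sq d)
      (fun ω => by positivity) (fun ω => sideSeqRatio_nonneg α d ω t)
  · convert (tendsto_integral_mul_min_one_sideSeqRatio α t).const_mul (α ^ 2 * t ^ 2) using 2
    simp only [integral_const_mul]
    ring

end Side

/-! ### The rescaled stretch variable and its uniform limit -/

section StretchLaw

variable {a : ℝ}

lemma stretchDensity_nonneg (z : ℝ) : 0 ≤ stretchDensity a z :=
  Set.indicator_nonneg (fun _ _ => by positivity) z

lemma measurable_stretchDensity : Measurable (stretchDensity a) :=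
  Measurable.indicator (by fun_prop) measurableSet_Icc

lemma one_div_sqrt_le (ha : 1 < a) {z : ℝ} (hz : 1 / a ≤ z) : 1 / √z ≤ √a := by
  have ha0 : 0 < a := by linarith
  have hz0 : 0 < z := lt_of_lt_of_le (by positivity) hz
  rw [one_div, ← Real.sqrt_inv]
  refine Real.sqrt_le_sqrt ?_
  rw [one_div] at hz
  exact inv_le_of_inv_le₀ ha0 hz

lemma abs_stretchDensity_le (ha : 1 < a) (z : ℝ) :
    |stretchDensity a z| ≤ (Set.Icc (1 / a) a).indicator (fun _ => √a) z := by
  rw [abs_of_nonneg (stretchDensity_nonneg z)]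
  unfold stretchDensity
  by_cases h : z ∈ Set.Icc (1 / a) a
  · simpa only [Set.indicator_of_mem h] using one_div_sqrt_le ha h.1
  · simp only [Set.indicator_of_notMem h, le_refl]

lemma integrable_stretchDensity (ha : 1 < a) : Integrable (stretchDensity a) := by
  refine Integrable.mono' ?_ measurable_stretchDensity.aestronglyMeasurable
    (ae_of_all _ (abs_stretchDensity_le ha))
  exact (integrable_indicator_iff measurableSet_Icc).2
    (integrableOn_const (by simp))

lemma integral_stretchDensity_pos (ha : 1 < a) : 0 < ∫ z, stretchDensity a z := by
  have h1 : 1 / a < a := by rw [div_lt_iff₀ (by linarith)]; nlinarith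
  rw [integral_pos_iff_support_of_nonneg stretchDensity_nonneg (integrable_stretchDensity ha)]
  refine lt_of_lt_of_le (b := volume (Set.Icc (1 / a) a)) (by simpa using h1)
    (measure_mono fun z hz => ?_)
  have hz0 : 0 < z := lt_of_lt_of_le (by positivity) hz.1
  rw [Function.mem_support, stretchDensity, Set.indicator_of_mem hz]
  positivity

lemma isProbabilityMeasure_stretchLaw (ha : 1 < a) : IsProbabilityMeasure (stretchLaw a) :=
  isProbabilityMeasure_lawOfDensity stretchDensity_nonneg (integrable_stretchDensity ha)
    (integral_stretchDensity_pos ha)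

lemma ae_mem_Icc_stretchLaw (a : ℝ) : ∀ᵐ z ∂(stretchLaw a), z ∈ Set.Icc (1 / a) a := by
  refine Measure.ae_smul_measure ?_ _
  rw [ae_withDensity_iff (by exact measurable_stretchDensity.ennreal_ofReal)]
  refine ae_of_all _ fun z hz => ?_
  by_contra h
  exact hz (by rw [stretchDensity, Set.indicator_of_notMem h, ENNReal.ofReal_zero])

/-- Substitute z = 1 + εu; the Jacobian cancels between the integral and the normalising constant.
-/
lemma integral_stretchLaw_eq {ε : ℝ} (hε : 0 < ε) (F : ℝ → ℝ) :
    ∫ z, F z ∂(stretchLaw (1 + ε))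
      = (∫ u, stretchDensity (1 + ε) (1 + ε * u))⁻¹
        * ∫ u, stretchDensity (1 + ε) (1 + ε * u) * F (1 + ε * u) := by
  have hsub (h : ℝ → ℝ) : ∫ u, h (1 + ε * u) = ε⁻¹ * ∫ z, h z := by
    rw [Measure.integral_comp_mul_left (fun x => h (1 + x)) ε, integral_add_left_eq_self h,
      abs_of_pos (by positivity), smul_eq_mul]
  rw [stretchLaw, integral_lawOfDensity stretchDensity_nonneg measurable_stretchDensity
    (integrable_stretchDensity (by linarith)), hsub (stretchDensity (1 + ε)),
    hsub fun z => stretchDensity (1 + ε) z * F z]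
  simp only [smul_eq_mul]
  rw [mul_inv, mul_mul_mul_comm, inv_mul_cancel₀ (inv_ne_zero hε.ne'), one_mul]

/-- Because (1 - ε)(1 + ε) < 1, the left endpoint 1/(1 + ε) lies strictly to the right of 1 - ε. -/
lemma neg_one_lt_of_one_div_le {ε u : ℝ} (hε : 0 < ε) (h : 1 / (1 + ε) ≤ 1 + ε * u) :
    -1 < u := by
  by_contra! hu
  rw [div_le_iff₀ (by linarith)] at h
  nlinarith [mul_pos hε hε, mul_le_mul_of_nonneg_left hu hε.le]

lemma abs_stretchDensity_one_add_mul_le {ε u : ℝ} (hε : 0 < ε) :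
    |stretchDensity (1 + ε) (1 + ε * u)| ≤ (Set.Icc (-1) 1).indicator (fun _ => √(1 + ε)) u := by
  refine (abs_stretchDensity_le (by linarith) _).trans ?_
  by_cases h : 1 + ε * u ∈ Set.Icc (1 / (1 + ε)) (1 + ε)
  · have hu : u ∈ Set.Icc (-1) 1 := by
      refine ⟨(neg_one_lt_of_one_div_le hε h.1).le, ?_⟩
      have := h.2
      nlinarith
    rw [Set.indicator_of_mem h, Set.indicator_of_mem hu]
  · rw [Set.indicator_of_notMem h]
    exact Set.indicator_nonneg (fun _ _ => by positivity) u

/-- At u = -1 the rescaled density vanishes whenever ε > 0, while the indicator equals 1; this null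
point has to be excluded. -/
lemma tendsto_stretchDensity {ε : ℕ → ℝ} (hε : ∀ᶠ d in atTop, 0 < ε d)
    (hlim : Tendsto ε atTop (𝓝 0)) {u : ℝ} (h1 : u ≠ -1) :
    Tendsto (fun d => stretchDensity (1 + ε d) (1 + ε d * u)) atTop
      (𝓝 ((Set.Icc (-1) 1).indicator (fun _ => (1 : ℝ)) u)) := by
  by_cases hu : u ∈ Set.Icc (-1) 1
  · rw [Set.indicator_of_mem hu]
    have hl : -1 < u := lt_of_le_of_ne hu.1 (Ne.symm h1)
    have hc : Tendsto (fun d => 1 / √(1 + ε d * u)) atTop (𝓝 1) := by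
      have : Tendsto (fun d => 1 / √(1 + ε d * u)) atTop (𝓝 (1 / √(1 + 0 * u))) :=
        tendsto_const_nhds.div ((tendsto_const_nhds.add (hlim.mul_const u)).sqrt) (by simp)
      simpa using this
    refine hc.congr' ?_
    -- Membership at the left endpoint amounts to 1 + u + εu ≥ 0, which this ensures since |u| ≤ 1.
    have h3 : ∀ᶠ d in atTop, ε d < 1 + u := hlim.eventually_lt_const (by linarith)
    filter_upwards [hε, h3] with d hd hd3
    rw [stretchDensity, Set.indicator_of_mem]
    refine ⟨?_, by nlinarith [hu.2]⟩
    rw [div_le_iff₀ (by linarith)]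
    have h4 : 0 ≤ ε d * (1 + u + ε d * u) := by
      refine mul_nonneg hd.le ?_
      rcases le_total 0 u with h0 | h0
      · nlinarith
      · nlinarith [hu.2]
    nlinarith
  · rw [Set.indicator_of_notMem hu]
    refine tendsto_const_nhds.congr' ?_
    filter_upwards [hε] with d hd
    have := abs_stretchDensity_one_add_mul_le (u := u) hd
    rw [Set.indicator_of_notMem hu] at this
    exact (abs_nonpos_iff.1 this).symm

lemma integral_unifLaw_neg_one_one (G : ℝ → ℝ) :
    ∫ u, G u ∂(unifLaw (-1) 1) = 2⁻¹ * ∫ u, (Set.Icc (-1) 1).indicator (fun _ => (1 : ℝ)) u * G u := by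
  have h : (fun u => (Set.Icc (-1) 1).indicator (fun _ => (1 : ℝ)) u * G u)
      = (Set.Icc (-1) 1).indicator G := by
    ext u; by_cases hu : u ∈ Set.Icc (-1 : ℝ) 1 <;> simp [Set.indicator, hu]
  rw [h, integral_indicator measurableSet_Icc, unifLaw, ProbabilityTheory.cond,
    integral_smul_measure, Real.volume_Icc, ENNReal.toReal_inv,
    ENNReal.toReal_ofReal (by norm_num)]
  norm_num

/-- Dominated convergence in numerator and normalising constant separately, the latter tending to 2.
The bound on `F` is needed only where the rescaled density is nonzero, and there the argument is
positive. -/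
lemma tendsto_integral_stretchLaw {ε : ℕ → ℝ} (hε : ∀ᶠ d in atTop, 0 < ε d)
    (hlim : Tendsto ε atTop (𝓝 0)) {F : ℕ → ℝ → ℝ} {G : ℝ → ℝ} (hF : ∀ d, Measurable (F d))
    {C : ℝ} (hC : ∀ᶠ d in atTop, ∀ u ∈ Set.Icc (-1 : ℝ) 1, 0 < 1 + ε d * u →
      |F d (1 + ε d * u)| ≤ C)
    (hG : ∀ u, Tendsto (fun d => F d (1 + ε d * u)) atTop (𝓝 (G u))) :
    Tendsto (fun d => ∫ z, F d z ∂(stretchLaw (1 + ε d))) atTop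
      (𝓝 (∫ u, G u ∂(unifLaw (-1) 1))) := by
  have hC0 : 0 ≤ C := by
    obtain ⟨d, hd⟩ := hC.exists
    exact (abs_nonneg _).trans (hd 0 (by simp) (by simp))
  have hε1 : ∀ᶠ d in atTop, ε d < 1 := hlim.eventually_lt_const one_pos
  -- The constant √2 bounds √(1 + ε) once ε < 1.
  have hbound : Integrable ((Set.Icc (-1 : ℝ) 1).indicator fun _ => √2) :=
    (integrable_indicator_iff measurableSet_Icc).2 (integrableOn_const (by simp))
  have hne : ∀ᵐ u : ℝ, u ≠ -1 := Measure.ae_ne volume (-1)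
  have hle : ∀ d, 0 < ε d → ε d < 1 → ∀ u, |stretchDensity (1 + ε d) (1 + ε d * u)|
      ≤ (Set.Icc (-1 : ℝ) 1).indicator (fun _ => √2) u := fun d h0 h1 u =>
    (abs_stretchDensity_one_add_mul_le h0).trans
      (Set.indicator_le_indicator (Real.sqrt_le_sqrt (by linarith)))
  have hmeas : ∀ d, Measurable fun u => stretchDensity (1 + ε d) (1 + ε d * u) := fun d =>
    measurable_stretchDensity.comp (by fun_prop)
  have hden : Tendsto (fun d => ∫ u, stretchDensity (1 + ε d) (1 + ε d * u)) atTop (𝓝 2) := by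
    have h := tendsto_integral_filter_of_dominated_convergence
      (F := fun d u => stretchDensity (1 + ε d) (1 + ε d * u)) _
      (Eventually.of_forall fun d => (hmeas d).aestronglyMeasurable)
      (by filter_upwards [hε, hε1] with d h0 h1 using ae_of_all _ (hle d h0 h1)) hbound
      (hne.mono fun u hu => tendsto_stretchDensity hε hlim hu)
    convert h using 2
    rw [integral_indicator measurableSet_Icc]
    norm_num
  have hnum : Tendsto (fun d => ∫ u, stretchDensity (1 + ε d) (1 + ε d * u) * F d (1 + ε d * u))
      atTop (𝓝 (∫ u, (Set.Icc (-1) 1).indicator (fun _ => (1 : ℝ)) u * G u)) := by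
    refine tendsto_integral_filter_of_dominated_convergence _
      (Eventually.of_forall fun d => ((hmeas d).mul
        ((hF d).comp (by fun_prop))).aestronglyMeasurable) ?_ (hbound.mul_const C)
      (hne.mono fun u hu => (tendsto_stretchDensity hε hlim hu).mul (hG u))
    filter_upwards [hε, hε1, hC] with d h0 h1 hd
    refine ae_of_all _ fun u => ?_
    rw [norm_mul]
    by_cases hu : stretchDensity (1 + ε d) (1 + ε d * u) = 0
    · rw [hu, norm_zero, zero_mul]
      exact mul_nonneg (Set.indicator_nonneg (fun _ _ => by positivity) u) hC0
    · have hmem : 1 + ε d * u ∈ Set.Icc (1 / (1 + ε d)) (1 + ε d) := by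
        by_contra h
        exact hu (Set.indicator_of_notMem h _)
      have hu1 : u ∈ Set.Icc (-1 : ℝ) 1 :=
        ⟨(neg_one_lt_of_one_div_le h0 hmem.1).le, by nlinarith [hmem.2]⟩
      have hpos : 0 < 1 + ε d * u := lt_of_lt_of_le (by positivity) hmem.1
      exact mul_le_mul (hle d h0 h1 u) (hd u hu1 hpos) (abs_nonneg _)
        (Set.indicator_nonneg (fun _ _ => by positivity) u)
  rw [integral_unifLaw_neg_one_one]
  refine ((hden.inv₀ two_ne_zero).mul hnum).congr' ?_
  filter_upwards [hε] with d hd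
  exact (integral_stretchLaw_eq hd (F d)).symm

end StretchLaw

/-! ### Asymptotics of the volume factor -/

section Drift

lemma abs_log_one_add_sub_le {x : ℝ} (hx : |x| < 1) :
    |Real.log (1 + x) - x + x ^ 2 / 2| ≤ |x| ^ 3 / (1 - |x|) := by
  have h := Real.abs_log_sub_add_sum_range_le (x := -x) (by simpa using hx) 2
  simp only [abs_neg, sub_neg_eq_add, Finset.sum_range_succ, Finset.sum_range_zero] at h
  convert h using 2
  push_cast
  ring

lemma tendsto_sqrt_natCast : Tendsto (fun d : ℕ => √(d : ℝ)) atTop atTop :=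
  Real.tendsto_sqrt_atTop.comp tendsto_natCast_atTop_atTop

/-- With δ = b/√d, expand log(1 + δ) to second order: (d - 1)δ = b√d - δ and (d - 1)δ²/2 = b²/2 -
δ²/2. The cubic remainder is of order dδ³, which vanishes. -/
lemma tendsto_stretch_drift (b : ℝ) :
    Tendsto (fun d : ℕ => ((d : ℝ) - 1) * Real.log (1 + b / √(d : ℝ)) - b * √(d : ℝ)) atTop
      (𝓝 (-b ^ 2 / 2)) := by
  have hδ : Tendsto (fun d : ℕ => b / √(d : ℝ)) atTop (𝓝 0) :=
    tendsto_sqrt_natCast.const_div_atTop b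
  have herr : Tendsto (fun d : ℕ => ((d : ℝ) - 1) *
      (Real.log (1 + b / √(d : ℝ)) - b / √(d : ℝ) + (b / √(d : ℝ)) ^ 2 / 2)) atTop (𝓝 0) := by
    have hb : Tendsto (fun d : ℕ => b ^ 2 * |b / √(d : ℝ)| / (1 - |b / √(d : ℝ)|)) atTop (𝓝 0) := by
      have h : b ^ 2 * |(0 : ℝ)| / (1 - |0|) = 0 := by simp
      rw [← h]
      exact (hδ.abs.const_mul (b ^ 2)).div (hδ.abs.const_sub 1) (by simp)
    refine squeeze_zero_norm' ?_ hb
    have hlt : ∀ᶠ d : ℕ in atTop, |b / √(d : ℝ)| < 1 :=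
      hδ.abs.eventually_lt_const (by simp)
    filter_upwards [hlt, eventually_ge_atTop 1] with d hd hd1
    have hd1' : (1 : ℝ) ≤ d := by exact_mod_cast hd1
    have hd0 : (d : ℝ) ≠ 0 := by positivity
    rw [norm_mul, Real.norm_of_nonneg (by linarith)]
    have h1 := abs_log_one_add_sub_le hd
    have h2 : 0 ≤ |b / √(d : ℝ)| ^ 3 / (1 - |b / √(d : ℝ)|) := (abs_nonneg _).trans h1
    -- Two powers of δ absorb the factor `d`, because dδ² = b².
    calc ((d : ℝ) - 1) * ‖_‖ ≤ d * (|b / √(d : ℝ)| ^ 3 / (1 - |b / √(d : ℝ)|)) :=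
          mul_le_mul (by linarith) h1 (abs_nonneg _) (by linarith)
      _ = b ^ 2 * |b / √(d : ℝ)| / (1 - |b / √(d : ℝ)|) := by
          have h3 : (d : ℝ) * |b / √(d : ℝ)| ^ 3 = b ^ 2 * |b / √(d : ℝ)| := by
            rw [pow_succ, sq_abs, div_pow, Real.sq_sqrt (by linarith), ← mul_assoc,
              mul_div_cancel₀ _ hd0]
          rw [← mul_div_assoc, h3]
  have hmain : Tendsto (fun d : ℕ => ((d : ℝ) - 1) *
      (Real.log (1 + b / √(d : ℝ)) - b / √(d : ℝ) + (b / √(d : ℝ)) ^ 2 / 2)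
      + (-(b / √(d : ℝ)) - b ^ 2 / 2 + (b / √(d : ℝ)) ^ 2 / 2)) atTop
      (𝓝 (0 + (-0 - b ^ 2 / 2 + 0 ^ 2 / 2))) :=
    herr.add ((hδ.neg.sub_const _).add ((hδ.pow 2).div_const 2))
  have e : (0 + (-0 - b ^ 2 / 2 + 0 ^ 2 / 2) : ℝ) = -b ^ 2 / 2 := by ring
  rw [e] at hmain
  refine hmain.congr' ?_
  filter_upwards [eventually_ge_atTop 1] with d hd1
  have hd1' : (1 : ℝ) ≤ d := by exact_mod_cast hd1
  have hs : √(d : ℝ) ≠ 0 := by positivity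
  have hd : (d : ℝ) = √(d : ℝ) ^ 2 := (Real.sq_sqrt (by linarith)).symm
  generalize Real.log (1 + b / √(d : ℝ)) = L
  generalize √(d : ℝ) = s at hs hd
  rw [hd]
  field_simp
  ring

end Drift

/-! ### The stretch move -/

section Stretch

lemma stretchProposal_eq {d : ℕ} (x y : EuclideanSpace ℝ (Fin d)) (z : ℝ) :
    stretchProposal x y z = x + (z - 1) • (x - y) := by
  unfold stretchProposal
  module

/-- The acceptance ratio of the stretch move along an i.i.d. sequence of triples. -/
noncomputable def stretchSeqRatio (d : ℕ) (ω : ℕ → ℝ × ℝ × ℝ) (z : ℝ) : ℝ :=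
  z ^ (d - 1) * Real.exp (-(z - 1) * ∑ k ∈ Finset.range d, (ω k).1 * ((ω k).1 - (ω k).2.1)
    - (z - 1) ^ 2 / 2 * ∑ k ∈ Finset.range d, ((ω k).1 - (ω k).2.1) ^ 2)

lemma stretchRatio_seqVec (d : ℕ) (ω : ℕ → ℝ × ℝ × ℝ) (z : ℝ) :
    stretchRatio (seqVec d (fun p => p.1) ω) (seqVec d (fun p => p.2.1) ω) z
      = stretchSeqRatio d ω z := by
  rw [stretchRatio, stretchProposal_eq, gaussDensity_add_div, seqVec_sub, inner_seqVec,
    norm_sq_seqVec, stretchSeqRatio]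

lemma norm_stretchNext_sub_sq {d : ℕ} (hd : d ≠ 0) (ω : ℕ → ℝ × ℝ × ℝ) (z r : ℝ) :
    ‖stretchNext (seqVec d (fun p => p.1) ω) (seqVec d (fun p => p.2.1) ω) z r
        - seqVec d (fun p => p.1) ω‖ ^ 2
      = if r ≤ stretchSeqRatio d ω z then
          d * (z - 1) ^ 2 * ((d : ℝ)⁻¹ * ∑ k ∈ Finset.range d, ((ω k).1 - (ω k).2.1) ^ 2)
        else 0 := by
  have hd' : (d : ℝ) ≠ 0 := by exact_mod_cast hd
  rw [stretchNext, norm_acceptReject_sub_sq, stretchRatio_seqVec, stretchProposal_eq,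
    add_sub_cancel_left, norm_smul, mul_pow, seqVec_sub, norm_sq_seqVec, Real.norm_eq_abs, sq_abs]
  congr 1
  field_simp

lemma measurable_stretchSeqRatio (d : ℕ) : Measurable (Function.uncurry (stretchSeqRatio d)) := by
  unfold stretchSeqRatio Function.uncurry; fun_prop

lemma stretchSeqRatio_nonneg {d : ℕ} (ω : ℕ → ℝ × ℝ × ℝ) {z : ℝ} (hz : 0 ≤ z) :
    0 ≤ stretchSeqRatio d ω z :=
  mul_nonneg (pow_nonneg hz _) (Real.exp_pos _).le

lemma measurable_stretchRatio {d : ℕ} :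
    Measurable fun p : EuclideanSpace ℝ (Fin d) × EuclideanSpace ℝ (Fin d) × ℝ × ℝ =>
      stretchRatio p.1 p.2.1 p.2.2.1 := by
  unfold stretchRatio stretchProposal gaussDensity; fun_prop

lemma measurable_stretchNext {d : ℕ} :
    Measurable fun p : EuclideanSpace ℝ (Fin d) × EuclideanSpace ℝ (Fin d) × ℝ × ℝ =>
      stretchNext p.1 p.2.1 p.2.2.1 p.2.2.2 := by
  unfold stretchNext acceptReject
  refine Measurable.ite (measurableSet_le (by fun_prop) measurable_stretchRatio) ?_ (by fun_prop)
  unfold stretchProposal; fun_prop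

lemma integrable_average_stretchDiff_sq (d : ℕ) :
    Integrable (fun ω : ℕ → ℝ × ℝ × ℝ =>
      (d : ℝ)⁻¹ * ∑ k ∈ Finset.range d, ((ω k).1 - (ω k).2.1) ^ 2) gaussTripleSeq :=
  integrable_average_infinitePi integrable_stretchDiff_sq d

section Laws

variable {a : ℝ}

lemma ae_stretchSeqRatio_nonneg (ha : 1 < a) (d : ℕ) :
    ∀ᵐ z ∂(stretchLaw a), ∀ ω, 0 ≤ stretchSeqRatio d ω z := by
  filter_upwards [ae_mem_Icc_stretchLaw a] with z hz ω
  exact stretchSeqRatio_nonneg ω (le_trans (by positivity) hz.1)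

lemma integrable_mul_sub_one_sq_stretchLaw (ha : 1 < a) (c : ℝ) :
    Integrable (fun z => c * (z - 1) ^ 2) (stretchLaw a) := by
  have := isProbabilityMeasure_stretchLaw ha
  refine Integrable.const_mul (Integrable.of_bound (C := a ^ 2)
    (by fun_prop : Measurable _).aestronglyMeasurable ?_) c
  filter_upwards [ae_mem_Icc_stretchLaw a] with z hz
  have h0 : 0 < z := lt_of_lt_of_le (by positivity) hz.1
  rw [Real.norm_of_nonneg (sq_nonneg _)]
  nlinarith [hz.2]

variable {Ω : Type*} [MeasurableSpace Ω] {P : Measure Ω} {d : ℕ}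
  {xi xj : Ω → EuclideanSpace ℝ (Fin d)} {Z r : Ω → ℝ}

lemma IsStretchInput.integral_min_one_ratio (ha : 1 < a) (h : IsStretchInput P a xi xj Z r) :
    ∫ ω, min 1 (stretchRatio (xi ω) (xj ω) (Z ω)) ∂P
      = ∫ z, ∫ ω, min 1 (stretchSeqRatio d ω z) ∂gaussTripleSeq ∂(stretchLaw a) := by
  have := isProbabilityMeasure_stretchLaw ha
  rw [← integral_min_one_prod (measurable_stretchSeqRatio d) (ae_stretchSeqRatio_nonneg ha d)]
  refine (integral_comp_eq_of_hasLaw h (hasLaw_stretch_coupling d _)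
    ((measurable_const (a := (1 : ℝ))).min measurable_stretchRatio)).trans ?_
  simp only [stretchRatio_seqVec]

lemma IsStretchInput.integrable_norm_sq (hd : d ≠ 0) (ha : 1 < a)
    (h : IsStretchInput P a xi xj Z r) :
    Integrable (fun ω => ‖stretchNext (xi ω) (xj ω) (Z ω) (r ω) - xi ω‖ ^ 2) P := by
  have := isProbabilityMeasure_stretchLaw ha
  refine (integrable_comp_iff_of_hasLaw h (hasLaw_stretch_coupling d _)
    ((measurable_stretchNext.sub measurable_fst).norm.pow_const 2)).2 ?_
  simp only [Pi.sub_apply, norm_stretchNext_sub_sq hd]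
  exact integrable_accept (integrable_mul_sub_one_sq_stretchLaw ha d)
    (integrable_average_stretchDiff_sq d) (measurable_stretchSeqRatio d)

lemma IsStretchInput.integral_norm_sq (hd : d ≠ 0) (ha : 1 < a)
    (h : IsStretchInput P a xi xj Z r) :
    ∫ ω, ‖stretchNext (xi ω) (xj ω) (Z ω) (r ω) - xi ω‖ ^ 2 ∂P
      = ∫ z, d * (z - 1) ^ 2 * ∫ ω, ((d : ℝ)⁻¹ * ∑ k ∈ Finset.range d, ((ω k).1 - (ω k).2.1) ^ 2)
          * min 1 (stretchSeqRatio d ω z) ∂gaussTripleSeq ∂(stretchLaw a) := by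
  have := isProbabilityMeasure_stretchLaw ha
  rw [← integral_accept (integrable_mul_sub_one_sq_stretchLaw ha d)
    (integrable_average_stretchDiff_sq d) (measurable_stretchSeqRatio d)
    (ae_stretchSeqRatio_nonneg ha d)]
  refine (integral_comp_eq_of_hasLaw h (hasLaw_stretch_coupling d _)
    ((measurable_stretchNext.sub measurable_fst).norm.pow_const 2)).trans ?_
  simp only [Pi.sub_apply, norm_stretchNext_sub_sq hd]

end Laws

lemma tendstoInDistribution_stretchField :
    TendstoInDistribution (fun (d : ℕ) (ω : ℕ → ℝ × ℝ × ℝ) =>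
      (√(d : ℝ))⁻¹ * ∑ k ∈ Finset.range d, (1 - (ω k).1 * ((ω k).1 - (ω k).2.1))) atTop
      -- By symmetry of `z` either sign is a valid limit; the negative one yields the stated
      -- exponent directly.
      (fun z => -√3 * z) (fun _ => gaussTripleSeq) (gaussianReal 0 1) :=
  tendstoInDistribution_sum_infinitePi
    (f := fun p : ℝ × ℝ × ℝ => 1 - p.1 * (p.1 - p.2.1))
    (by fun_prop) memLp_stretchField integral_stretchField
    (by rw [integral_stretchField_sq, neg_sq])

lemma tendsto_integral_abs_average_stretchDiff_sq :
    Tendsto (fun d : ℕ => ∫ ω : ℕ → ℝ × ℝ × ℝ,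
      |(d : ℝ)⁻¹ * ∑ k ∈ Finset.range d, ((ω k).1 - (ω k).2.1) ^ 2 - 2| ∂gaussTripleSeq)
      atTop (𝓝 0) := by
  have h := tendsto_integral_abs_average_sub_infinitePi
    (f := fun p : ℝ × ℝ × ℝ => (p.1 - p.2.1) ^ 2) (by fun_prop) integrable_stretchDiff_sq
  rwa [integral_stretchDiff_sq] at h

lemma integral_average_stretchDiff_sq {d : ℕ} (hd : d ≠ 0) :
    ∫ ω : ℕ → ℝ × ℝ × ℝ, (d : ℝ)⁻¹ * ∑ k ∈ Finset.range d, ((ω k).1 - (ω k).2.1) ^ 2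
      ∂gaussTripleSeq = 2 :=
  (integral_average_infinitePi (by fun_prop) integrable_stretchDiff_sq hd).trans
    integral_stretchDiff_sq

/-- Centring the linear sum by its mean `d` adds βu√d to the exponent; subtracting it from the
logarithm of the volume factor leaves a convergent drift. -/
lemma stretchSeqRatio_eq_exp {d : ℕ} (hd : 1 ≤ d) {β u : ℝ} (hu : 0 < 1 + β / √(d : ℝ) * u)
    (ω : ℕ → ℝ × ℝ × ℝ) :
    stretchSeqRatio d ω (1 + β / √(d : ℝ) * u)
      = Real.exp ((((d : ℝ) - 1) * Real.log (1 + β * u / √(d : ℝ)) - β * u * √(d : ℝ))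
        + β * u * ((√(d : ℝ))⁻¹ * ∑ k ∈ Finset.range d, (1 - (ω k).1 * ((ω k).1 - (ω k).2.1)))
        - (β * u) ^ 2 / 2 * ((d : ℝ)⁻¹ * ∑ k ∈ Finset.range d, ((ω k).1 - (ω k).2.1) ^ 2)) := by
  have hd1 : (1 : ℝ) ≤ d := by exact_mod_cast hd
  have hs : √(d : ℝ) ≠ 0 := by positivity
  have hd2 : (d : ℝ) = √(d : ℝ) ^ 2 := (Real.sq_sqrt (by linarith)).symm
  have hlog : (1 + β / √(d : ℝ) * u) ^ (d - 1)
      = Real.exp (((d : ℝ) - 1) * Real.log (1 + β * u / √(d : ℝ))) := by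
    rw [div_mul_eq_mul_div] at hu ⊢
    rw [← Nat.cast_pred hd, Real.exp_nat_mul, Real.exp_log hu]
  rw [stretchSeqRatio, hlog, ← Real.exp_add, Finset.sum_sub_distrib, Finset.sum_const,
    Finset.card_range, nsmul_eq_mul, mul_one]
  congr 1
  generalize Real.log (1 + β * u / √(d : ℝ)) = L
  generalize √(d : ℝ) = s at hs hd2
  rw [hd2]
  field_simp
  ring

lemma eventually_one_add_div_sqrt_mul_pos (β u : ℝ) :
    ∀ᶠ d : ℕ in atTop, 0 < 1 + β / √(d : ℝ) * u := by
  have h : Tendsto (fun d : ℕ => 1 + β / √(d : ℝ) * u) atTop (𝓝 (1 + 0 * u)) :=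
    ((tendsto_sqrt_natCast.const_div_atTop β).mul_const u).const_add 1
  exact h.eventually_const_lt (by simp)

lemma stretch_exponent_eq (β u z : ℝ) :
    -(β * u) ^ 2 / 2 - (β * u) ^ 2 / 2 * 2 + β * u * (-√3 * z)
      = -(3 / 2) * β ^ 2 * u ^ 2 - √3 * β * u * z := by
  ring

lemma tendsto_integral_min_one_stretchSeqRatio (β u : ℝ) :
    Tendsto (fun d : ℕ => ∫ ω, min 1 (stretchSeqRatio d ω (1 + β / √(d : ℝ) * u)) ∂gaussTripleSeq)
      atTop (𝓝 (∫ z, min 1 (Real.exp (-(3 / 2) * β ^ 2 * u ^ 2 - √3 * β * u * z))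
        ∂(gaussianReal 0 1))) := by
  have h := tendsto_integral_min_one_exp tendstoInDistribution_stretchField
    integrable_average_stretchDiff_sq tendsto_integral_abs_average_stretchDiff_sq
    (tendsto_stretch_drift (β * u)) (β * u) ((β * u) ^ 2 / 2)
  simp only [stretch_exponent_eq] at h
  refine h.congr' ?_
  filter_upwards [eventually_one_add_div_sqrt_mul_pos β u, eventually_ge_atTop 1] with d hu hd
  simp only [stretchSeqRatio_eq_exp hd hu]

lemma tendsto_integral_mul_min_one_stretchSeqRatio (β u : ℝ) :
    Tendsto (fun d : ℕ => ∫ ω, ((d : ℝ)⁻¹ * ∑ k ∈ Finset.range d, ((ω k).1 - (ω k).2.1) ^ 2)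
        * min 1 (stretchSeqRatio d ω (1 + β / √(d : ℝ) * u)) ∂gaussTripleSeq)
      atTop (𝓝 (2 * ∫ z, min 1 (Real.exp (-(3 / 2) * β ^ 2 * u ^ 2 - √3 * β * u * z))
        ∂(gaussianReal 0 1))) := by
  have h := tendsto_integral_mul_min_one_exp tendstoInDistribution_stretchField
    integrable_average_stretchDiff_sq tendsto_integral_abs_average_stretchDiff_sq
    (tendsto_stretch_drift (β * u)) (β * u) ((β * u) ^ 2 / 2)
  simp only [stretch_exponent_eq] at h
  refine h.congr' ?_
  filter_upwards [eventually_one_add_div_sqrt_mul_pos β u, eventually_ge_atTop 1] with d hu hd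
  simp only [stretchSeqRatio_eq_exp hd hu]

lemma isProbabilityMeasure_unifLaw {a b : ℝ} (h : a < b) : IsProbabilityMeasure (unifLaw a b) :=
  cond_isProbabilityMeasure_of_finite (by simpa using h) (by simp)

lemma integrable_sq_unifLaw : Integrable (fun u => u ^ 2) (unifLaw (-1) 1) := by
  have := isProbabilityMeasure_unifLaw (show (-1 : ℝ) < 1 by norm_num)
  refine Integrable.of_bound (C := 1) (by fun_prop : Measurable _).aestronglyMeasurable ?_
  filter_upwards [ae_cond_mem (μ := volume) (measurableSet_Icc (a := (-1 : ℝ)) (b := 1))] with u hu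
  rw [Real.norm_of_nonneg (sq_nonneg _)]
  nlinarith [hu.1, hu.2]

variable {β : ℝ}

lemma eventually_div_sqrt_pos (hβ : 0 < β) : ∀ᶠ d : ℕ in atTop, 0 < β / √(d : ℝ) := by
  filter_upwards [eventually_gt_atTop 0] with d hd
  have : (0 : ℝ) < d := by exact_mod_cast hd
  positivity

theorem tendsto_stretch_acceptance (hβ : 0 < β) :
    Tendsto (fun d : ℕ => ∫ z, ∫ ω, min 1 (stretchSeqRatio d ω z) ∂gaussTripleSeq
        ∂(stretchLaw (1 + β / √(d : ℝ))))
      atTop (𝓝 (∫ p : ℝ × ℝ,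
          min 1 (Real.exp (-(3 / 2) * β ^ 2 * p.1 ^ 2 - √3 * β * p.1 * p.2))
          ∂((unifLaw (-1) 1).prod (gaussianReal 0 1)))) := by
  have := isProbabilityMeasure_unifLaw (show (-1 : ℝ) < 1 by norm_num)
  rw [integral_prod _ (integrable_min_one_exp (by fun_prop))]
  refine tendsto_integral_stretchLaw (C := 1) (eventually_div_sqrt_pos hβ)
    (tendsto_sqrt_natCast.const_div_atTop β) (fun d => ?_)
    (Eventually.of_forall fun d u _ hu =>
      abs_integral_min_one_le fun ω => stretchSeqRatio_nonneg ω hu.le)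
    (tendsto_integral_min_one_stretchSeqRatio β)
  simpa using measurable_integral_mul_min_one (Q := gaussTripleSeq) measurable_const
    (measurable_stretchSeqRatio d) (N := fun _ => (1 : ℝ))

theorem tendsto_stretch_jump (hβ : 0 < β) :
    Tendsto (fun d : ℕ => ∫ z, d * (z - 1) ^ 2 * ∫ ω,
        ((d : ℝ)⁻¹ * ∑ k ∈ Finset.range d, ((ω k).1 - (ω k).2.1) ^ 2)
          * min 1 (stretchSeqRatio d ω z) ∂gaussTripleSeq ∂(stretchLaw (1 + β / √(d : ℝ))))
      atTop (𝓝 (2 * β ^ 2 * ∫ p : ℝ × ℝ,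
          p.1 ^ 2 * min 1 (Real.exp (-(3 / 2) * β ^ 2 * p.1 ^ 2 - √3 * β * p.1 * p.2))
          ∂((unifLaw (-1) 1).prod (gaussianReal 0 1)))) := by
  have := isProbabilityMeasure_unifLaw (show (-1 : ℝ) < 1 by norm_num)
  have hI : Integrable (fun p : ℝ × ℝ =>
      p.1 ^ 2 * min 1 (Real.exp (-(3 / 2) * β ^ 2 * p.1 ^ 2 - √3 * β * p.1 * p.2)))
      ((unifLaw (-1) 1).prod (gaussianReal 0 1)) :=
    (integrable_sq_unifLaw.comp_fst _).mul_bdd (c := 1)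
      (by fun_prop : Measurable _).aestronglyMeasurable
      (ae_of_all _ fun _ => abs_min_one_exp_le _)
  -- In the rescaled variable the jump prefactor no longer depends on `d`.
  have hk : ∀ {d : ℕ}, d ≠ 0 → ∀ u : ℝ,
      (d : ℝ) * (1 + β / √(d : ℝ) * u - 1) ^ 2 = β ^ 2 * u ^ 2 := by
    intro d hd u
    have hd' : (d : ℝ) ≠ 0 := by exact_mod_cast hd
    rw [add_sub_cancel_left, mul_pow, div_pow, Real.sq_sqrt (Nat.cast_nonneg d)]
    field_simp
  rw [integral_prod _ hI, ← integral_const_mul]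
  refine tendsto_integral_stretchLaw (C := β ^ 2 * 2) (eventually_div_sqrt_pos hβ)
    (tendsto_sqrt_natCast.const_div_atTop β) (fun d => ?_) ?_ (fun u => ?_)
  · exact Measurable.mul (by fun_prop) (measurable_integral_mul_min_one (by fun_prop)
      (measurable_stretchSeqRatio d))
  · filter_upwards [eventually_ne_atTop 0] with d hd u hu hpos
    rw [hk hd, abs_mul, abs_of_nonneg (by positivity)]
    have hu2 : u ^ 2 ≤ 1 := by nlinarith [hu.1, hu.2]
    refine mul_le_mul (mul_le_of_le_one_right (sq_nonneg β) hu2) ?_ (abs_nonneg _) (sq_nonneg β)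
    rw [← integral_average_stretchDiff_sq hd]
    exact abs_integral_mul_min_one_le (integrable_average_stretchDiff_sq d)
      (fun ω => by positivity) (fun ω => stretchSeqRatio_nonneg ω hpos.le)
  · have h := (tendsto_integral_mul_min_one_stretchSeqRatio β u).const_mul (β ^ 2 * u ^ 2)
    have e : 2 * β ^ 2 * ∫ z, u ^ 2 *
        min 1 (Real.exp (-(3 / 2) * β ^ 2 * u ^ 2 - √3 * β * u * z)) ∂(gaussianReal 0 1)
        = β ^ 2 * u ^ 2 * (2 * ∫ z,
          min 1 (Real.exp (-(3 / 2) * β ^ 2 * u ^ 2 - √3 * β * u * z)) ∂(gaussianReal 0 1)) := by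
      rw [integral_const_mul]
      ring
    rw [e]
    refine h.congr' ?_
    filter_upwards [eventually_ne_atTop 0] with d hd
    rw [hk hd]

lemma one_lt_one_add_div_sqrt (hβ : 0 < β) {d : ℕ} (hd : 1 ≤ d) : 1 < 1 + β / √(d : ℝ) := by
  have : (0 : ℝ) < d := by exact_mod_cast hd
  have : 0 < β / √(d : ℝ) := by positivity
  linarith

end Stretch

/-! ### The scaling limits -/

theorem proposition1 :
    -- side move with `σ = α / √d`
    (∀ (α : ℝ) {Ω : ℕ → Type*} [∀ d, MeasurableSpace (Ω d)]
      (P : ∀ d, Measure (Ω d)) [∀ d, IsProbabilityMeasure (P d)]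
      (xi xj xk : ∀ d, Ω d → EuclideanSpace ℝ (Fin d)) (ξ r : ∀ d, Ω d → ℝ),
      (∀ d : ℕ, 1 ≤ d → IsSideInput (P d) (xi d) (xj d) (xk d) (ξ d) (r d)) →
      Tendsto
        (fun d : ℕ => ∫ ω, min 1
          (sideRatio (α / √(d : ℝ)) (xi d ω) (xj d ω) (xk d ω) (ξ d ω)) ∂(P d))
        atTop
        (𝓝 (∫ p : ℝ × ℝ, min 1 (Real.exp (-α ^ 2 * p.1 ^ 2 - √2 * α * p.1 * p.2))
          ∂((gaussianReal 0 1).prod (gaussianReal 0 1)))) ∧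
      (∀ d : ℕ, 1 ≤ d → Integrable
        (fun ω => ‖sideNext (α / √(d : ℝ)) (xi d ω) (xj d ω) (xk d ω) (ξ d ω) (r d ω)
          - xi d ω‖ ^ 2) (P d)) ∧
      Tendsto
        (fun d : ℕ => ∫ ω, ‖sideNext (α / √(d : ℝ)) (xi d ω) (xj d ω) (xk d ω) (ξ d ω) (r d ω)
          - xi d ω‖ ^ 2 ∂(P d))
        atTop
        (𝓝 (2 * α ^ 2 * ∫ p : ℝ × ℝ,
          p.1 ^ 2 * min 1 (Real.exp (-α ^ 2 * p.1 ^ 2 - √2 * α * p.1 * p.2))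
          ∂((gaussianReal 0 1).prod (gaussianReal 0 1))))) ∧
    -- stretch move with `a = 1 + β / √d`
    (∀ (β : ℝ), 0 < β → ∀ {Ω : ℕ → Type*} [∀ d, MeasurableSpace (Ω d)]
      (P : ∀ d, Measure (Ω d)) [∀ d, IsProbabilityMeasure (P d)]
      (xi xj : ∀ d, Ω d → EuclideanSpace ℝ (Fin d)) (Z r : ∀ d, Ω d → ℝ),
      (∀ d : ℕ, 1 ≤ d → IsStretchInput (P d) (1 + β / √(d : ℝ)) (xi d) (xj d) (Z d) (r d)) →
      Tendsto
        (fun d : ℕ => ∫ ω, min 1 (stretchRatio (xi d ω) (xj d ω) (Z d ω)) ∂(P d))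
        atTop
        (𝓝 (∫ p : ℝ × ℝ,
          min 1 (Real.exp (-(3 / 2) * β ^ 2 * p.1 ^ 2 - √3 * β * p.1 * p.2))
          ∂((unifLaw (-1) 1).prod (gaussianReal 0 1)))) ∧
      (∀ d : ℕ, 1 ≤ d → Integrable
        (fun ω => ‖stretchNext (xi d ω) (xj d ω) (Z d ω) (r d ω) - xi d ω‖ ^ 2) (P d)) ∧
      Tendsto
        (fun d : ℕ => ∫ ω, ‖stretchNext (xi d ω) (xj d ω) (Z d ω) (r d ω) - xi d ω‖ ^ 2 ∂(P d))
        atTop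
        (𝓝 (2 * β ^ 2 * ∫ p : ℝ × ℝ,
          p.1 ^ 2 * min 1 (Real.exp (-(3 / 2) * β ^ 2 * p.1 ^ 2 - √3 * β * p.1 * p.2))
          ∂((unifLaw (-1) 1).prod (gaussianReal 0 1))))) := by
  refine ⟨fun α Ω _ P _ xi xj xk ξ r h => ⟨?_, fun d hd => (h d hd).integrable_norm_sq, ?_⟩,
    fun β hβ Ω _ P _ xi xj Z r h => ⟨?_, fun d hd =>
      (h d hd).integrable_norm_sq (Nat.one_le_iff_ne_zero.1 hd) (one_lt_one_add_div_sqrt hβ hd),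
      ?_⟩⟩
  · refine (tendsto_side_acceptance α).congr' ?_
    filter_upwards [eventually_ge_atTop 1] with d hd
    exact (h d hd).integral_min_one_ratio.symm
  · refine (tendsto_side_jump α).congr' ?_
    filter_upwards [eventually_ge_atTop 1] with d hd
    exact (h d hd).integral_norm_sq.symm
  · refine (tendsto_stretch_acceptance hβ).congr' ?_
    filter_upwards [eventually_ge_atTop 1] with d hd
    exact ((h d hd).integral_min_one_ratio (one_lt_one_add_div_sqrt hβ hd)).symm
  · refine (tendsto_stretch_jump hβ).congr' ?_
    filter_upwards [eventually_ge_atTop 1] with d hd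
    exact ((h d hd).integral_norm_sq (Nat.one_le_iff_ne_zero.1 hd)
      (one_lt_one_add_div_sqrt hβ hd)).symm
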